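/- **Setting.** Let $T$ be an $N\times N$ matrix with entries in $\{0,1\}$, $\Sigma_T^+=\{(x_i)_{i\ge0}: T_{x_ix_{i+1}}=1\ \forall i\}$ with the product topology and shift map $\sigma$, and let $h_{\rm top}$ be the topological entropy of $\sigma$ on $\Sigma_T^+$. For a function $f$ on $\Sigma_T^+$ with values in a normed space put $\mathrm{var}_n f=\sup\{\|f(x)-f(y)\|: x_i=y_i,\ 0\le i\le n-1\}$. A multicone for a nonempty set $\mathsf A$ of real $d\times d$ matrices, with transverse defining vector $w$ (a unit vector of $\mathbb R^d$), is a tuple $(\mathcal K_1,\dots,\mathcal K_m)$, $m\ge1$, of closed convex subsets of $\mathbb R^d$ with nonempty interior such that: $\lambda\mathcal K_j\subseteq\mathcal K_j$ for all $\lambda\ge0$; $\langle u,w\rangle>0$ for all $0\ne u\in\bigcup_j\mathcal K_j$; for all $A\in\mathsf A$ and all $j$ there is $\ell$ with $A(\mathcal K_j\setminus\{0\})\subseteq\operatorname{int}\mathcal K_\ell\cup(-\operatorname{int}\mathcal K_\ell)$; and $\mathcal K_i\cap\mathcal K_j=\{0\}$ for $i\ne j$. Put $$U_j=\{z=\lambda((u+v)+i(u-v)):\lambda\in\mathbb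 C,\ u,v\in\operatorname{int}\mathcal K_j,\ \langle z,w\rangle=1\},\qquad U=\bigcup_jU_j,$$ where $\langle z,w\rangle=\sum_k z_kw_k$; $U$ is a relatively open subset of the hyperplane $\{\langle z,w\rangle=1\}\subset\mathbb C^d$. Write $\overline A z=\langle Az,w\rangle^{-1}Az$. Let $\varphi:\Sigma_T^+\to\mathbb R$, and let $\mathcal A:\Sigma_T^+\to GL_d(\mathbb R)$ be continuous, such that $(\mathcal K_1,\dots,\mathcal K_m)$ is a multicone for $\mathcal A(\Sigma_T^+)$ with transverse defining vector $w$, and such that for every symbol $s$ and every $j$ there is $\ell$ with $\overline{\mathcal A(x)}U_j\subseteq U_\ell$ for all $x$ with $x_0=s$. Let $c>0$, let $p\ge1$ be real, put $\kappa_n=e^{-cn^p}$ and assume $\mathrm{var}_n\varphi=O(\kappa_n)$ and $\mathrm{var}_n\mathcal A=O(\kappa_n)$. Let $\mathcal B$ be the normed space of functions $f$ on $\Sigma_T^+\times U$ such that $f(x,\cdot)$ is holomorphic on $U$ for every $x$, $f(\cdot,z)$ is continuous for every $z$, and $$\|f\|_{\mathcal B}=\sup_{z\in U}\Big(\|f(\cdot,z)\|_\infty+\sup_{k\ge1}\kappa_k^{-1}\mathrm{var}_kf(\cdot,z)\Big)<\infty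 .$$ Let $\beta\in\mathbb R$ and let $\|\cdot\|$ be a norm on $\mathbb R^d$ such that $\log\|\cdot\|$, restricted to the real points of $U$, extends to a holomorphic function $\ell$ on $U$ with $e^{-\beta\ell}$ bounded on $U$. (For instance a norm with $\|u\|=\langle u,w\rangle$ on $\bigcup_j\mathcal K_j$, with $\ell=0$.) For $A=\mathcal A(x)$ and $z\in U$ let $$g_{\beta}(A,z)=\big(\langle Az,w\rangle^2\big)^{\beta/2}e^{\beta(\ell(\overline Az)-\ell(z))}$$ (principal branch; $\operatorname{Re}\langle Az,w\rangle\ne0$ on $U$); this is the analytic continuation to $U$ of $z\mapsto\|A\frac z{\|z\|}\|^\beta$ from the real points of $U$. Let $$\mathcal L_\beta f(x,z)=\sum_{i:\,ix\in\Sigma_T^+}e^{\varphi(ix)}\,g_\beta(\mathcal A(ix),z)\,f\big(ix,\overline{\mathcal A(ix)}z\big).$$ **Theorem.** $\mathcal L_\beta$ is a bounded linear operator on $\mathcal B$. For every integer $q\ge1$ and every $\varepsilon>0$ there is a constant $C>0$ such that for all $n\ge1$ $$a_n(\mathcal L_\beta^q)\le C\exp\Big[-pqc\,\big(\log n^{k}\big)^{p-1}\Big],\qquad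 k=\frac1{h_{\rm top}+\varepsilon},$$ where $a_n(L)=\inf\{\|L-F\|: F \text{ a bounded operator on }\mathcal B\text{ of rank}<n\}$. -/

import Mathlib

open Set Matrix
open scoped NNReal ENNReal

noncomputable section

namespace FastLyapunov

/-! ### Shifts of finite type -/

/-- The one-sided shift of finite type `Σ_T⁺` defined by the matrix `T`. -/
def SFT {N : ℕ} (T : Matrix (Fin N) (Fin N) ℕ) : Type :=
  {x : ℕ → Fin N // ∀ i, T (x i) (x (i + 1)) = 1}

namespace SFT

variable {N : ℕ} {T : Matrix (Fin N) (Fin N) ℕ}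

/-- The (compact, metrizable) uniform structure induced from the product of discrete spaces. -/
instance : UniformSpace (SFT T) :=
  UniformSpace.comap (fun x : SFT T => x.1) 
    (@Pi.uniformSpace ℕ (fun _ => Fin N) fun _ => ⊥)

/-- The shift map `σ`. -/
def shift (x : SFT T) : SFT T := ⟨fun i => x.1 (i + 1), fun i => x.2 (i + 1)⟩

/-- The point `ix`, for a symbol `i` such that `ix` is admissible. -/
def cons (x : SFT T) (i : {i : Fin N // T i (x.1 0) = 1}) : SFT T :=
  ⟨fun n => Nat.casesOn n i.1 x.1, fun n => by
    cases n with
    | zero => exact i.2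
    | succ n => exact x.2 n⟩

/-- The topological entropy `h_top` of the shift map on `Σ_T⁺`. -/
def entropy (T : Matrix (Fin N) (Fin N) ℕ) : ℝ :=
  (Dynamics.coverEntropy (shift : SFT T → SFT T) univ).toReal

/-- The variation `var_n f = sup {d(f x, f y) : x_i = y_i for 0 ≤ i ≤ n - 1}`. -/
def var {V : Type*} [PseudoEMetricSpace V] (n : ℕ) (f : SFT T → V) : ℝ≥0∞ :=
  ⨆ (x : SFT T) (y : SFT T) (_ : ∀ i < n, x.1 i = y.1 i), edist (f x) (f y)

/-- `var_n f = O(κ_n)`. -/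
def VarBigO {V : Type*} [PseudoEMetricSpace V] (f : SFT T → V) (κ : ℕ → ℝ) : Prop :=
  ∃ M : ℝ≥0, ∀ n, 1 ≤ n → var n f ≤ M * ENNReal.ofReal (κ n)

end SFT

/-! ### Multicones and their complexifications -/

variable {N d m : ℕ}

/-- `(K_1, …, K_m)` is a multicone for the set `S` of real matrices, with transverse defining
vector `w`. -/
structure IsMulticone (S : Set (Matrix (Fin d) (Fin d) ℝ)) (K : Fin m → Set (Fin d → ℝ))
    (w : Fin d → ℝ) : Prop where
  set_nonempty : S.Nonempty
  pos : 0 < m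
  isClosed : ∀ j, IsClosed (K j)
  convex : ∀ j, Convex ℝ (K j)
  interior_nonempty : ∀ j, (interior (K j)).Nonempty
  smul_mem : ∀ j, ∀ r : ℝ, 0 ≤ r → ∀ u ∈ K j, r • u ∈ K j
  unit : w ⬝ᵥ w = 1
  transverse : ∀ j, ∀ u ∈ K j, u ≠ 0 → 0 < u ⬝ᵥ w
  maps : ∀ A ∈ S, ∀ j, ∃ l, ∀ u ∈ K j, u ≠ 0 →
    A *ᵥ u ∈ interior (K l) ∨ -(A *ᵥ u) ∈ interior (K l)
  inter_eq : ∀ i j, i ≠ j → K i ∩ K j = {0}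

/-- A real vector regarded as a complex vector. -/
def toC (u : Fin d → ℝ) : Fin d → ℂ := fun k => (u k : ℂ)

/-- A real matrix acting on complex vectors. -/
def act (A : Matrix (Fin d) (Fin d) ℝ) (z : Fin d → ℂ) : Fin d → ℂ :=
  A.map (fun a : ℝ => (a : ℂ)) *ᵥ z

/-- The complex-linear functional `z ↦ ⟨z, w⟩`. -/
def pair (z : Fin d → ℂ) (w : Fin d → ℝ) : ℂ := z ⬝ᵥ toC w

/-- The domain attached to one cone `K`: all `z = λ ((u + v) + i (u - v))` with `λ ∈ ℂ`, `u, v` in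
the interior of `K`, and `⟨z, w⟩ = 1`. It is relatively open in the hyperplane `⟨z, w⟩ = 1`. -/
def coneDomain (K : Set (Fin d → ℝ)) (w : Fin d → ℝ) : Set (Fin d → ℂ) :=
  {z | pair z w = 1 ∧ ∃ c : ℂ, ∃ u ∈ interior K, ∃ v ∈ interior K,
    z = c • (toC (u + v) + Complex.I • toC (u - v))}

/-- The domain `U = ⋃ j, U_j`. -/
def domain (K : Fin m → Set (Fin d → ℝ)) (w : Fin d → ℝ) : Set (Fin d → ℂ) :=
  ⋃ j, coneDomain (K j) w

/-- The projective action `z ↦ ⟨A z, w⟩⁻¹ A z`. -/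
def proj (w : Fin d → ℝ) (A : Matrix (Fin d) (Fin d) ℝ) (z : Fin d → ℂ) : Fin d → ℂ :=
  (pair (act A z) w)⁻¹ • act A z

/-- The cocycle `A` is continuous, `(K, w)` is a multicone for its range, and for every symbol `s`
and every `i` the maps `proj w (A x)` with `x_0 = s` send `U_i` into one common `U_l`. -/
structure HypH1 {T : Matrix (Fin N) (Fin N) ℕ} (A : SFT T → GL (Fin d) ℝ)
    (K : Fin m → Set (Fin d → ℝ)) (w : Fin d → ℝ) : Prop where
  continuous : Continuous A
  isMulticone : IsMulticone (range fun x => (A x : Matrix (Fin d) (Fin d) ℝ)) K w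
  locally_constant : ∀ (s : Fin N) (i : Fin m), ∃ l : Fin m, ∀ x : SFT T, x.1 0 = s →
    MapsTo (proj w (A x : Matrix (Fin d) (Fin d) ℝ)) (coneDomain (K i) w) (coneDomain (K l) w)

/-! ### The space `𝓑(U, κ)` -/

variable {T : Matrix (Fin N) (Fin N) ℕ}

/-- `sup_{z ∈ U} (‖f(·, z)‖_∞ + sup_{k ≥ 1} κ_k⁻¹ var_k f(·, z))`, with values in `[0, ∞]`. -/
def bNorm (U : Set (Fin d → ℂ)) (κ : ℕ → ℝ) (f : SFT T → (Fin d → ℂ) → ℂ) : ℝ≥0∞ :=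
  ⨆ z ∈ U, ((⨆ x, ‖f x z‖ₑ) +
    ⨆ (k : ℕ) (_ : 1 ≤ k), SFT.var k (fun x => f x z) / ENNReal.ofReal (κ k))

theorem var_add_le (k : ℕ) (f g : SFT T → ℂ) :
    SFT.var k (fun x => f x + g x) ≤ SFT.var k f + SFT.var k g := by
  refine iSup_le fun x => iSup_le fun y => iSup_le fun h => ?_
  refine (edist_add_add_le _ _ _ _).trans (add_le_add ?_ ?_)
  · exact le_iSup_of_le x (le_iSup_of_le y (le_iSup_of_le h le_rfl))
  · exact le_iSup_of_le x (le_iSup_of_le y (le_iSup_of_le h le_rfl))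

theorem var_smul (k : ℕ) (c : ℂ) (f : SFT T → ℂ) :
    SFT.var k (fun x => c * f x) = ‖c‖ₑ * SFT.var k f := by
  simp only [SFT.var, ENNReal.mul_iSup, edist_eq_enorm_sub, ← mul_sub, enorm_mul]

theorem bNorm_add_le (U : Set (Fin d → ℂ)) (κ : ℕ → ℝ) (f g : SFT T → (Fin d → ℂ) → ℂ) :
    bNorm U κ (f + g) ≤ bNorm U κ f + bNorm U κ g := by
  refine iSup₂_le fun z hz => ?_
  have hf := le_iSup₂ (f := fun z (_ : z ∈ U) => ((⨆ x, ‖f x z‖ₑ) +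
    ⨆ (k : ℕ) (_ : 1 ≤ k), SFT.var k (fun x => f x z) / ENNReal.ofReal (κ k))) z hz
  have hg := le_iSup₂ (f := fun z (_ : z ∈ U) => ((⨆ x, ‖g x z‖ₑ) +
    ⨆ (k : ℕ) (_ : 1 ≤ k), SFT.var k (fun x => g x z) / ENNReal.ofReal (κ k))) z hz
  refine le_trans ?_ (add_le_add hf hg)
  rw [add_add_add_comm]
  refine add_le_add (iSup_le fun x => ?_) (iSup₂_le fun k hk => ?_)
  · refine (enorm_add_le _ _).trans (add_le_add ?_ ?_)
    · exact le_iSup (fun x => ‖f x z‖ₑ) x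
    · exact le_iSup (fun x => ‖g x z‖ₑ) x
  · refine (ENNReal.div_le_div_right (var_add_le k (fun x => f x z) (fun x => g x z)) _).trans ?_
    rw [ENNReal.add_div]
    refine add_le_add ?_ ?_
    · exact le_iSup₂ (f := fun (k : ℕ) (_ : 1 ≤ k) =>
        SFT.var k (fun x => f x z) / ENNReal.ofReal (κ k)) k hk
    · exact le_iSup₂ (f := fun (k : ℕ) (_ : 1 ≤ k) =>
        SFT.var k (fun x => g x z) / ENNReal.ofReal (κ k)) k hk

theorem bNorm_smul (U : Set (Fin d → ℂ)) (κ : ℕ → ℝ) (c : ℂ) (f : SFT T → (Fin d → ℂ) → ℂ) :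
    bNorm U κ (c • f) = ‖c‖ₑ * bNorm U κ f := by
  simp only [bNorm, Pi.smul_apply, smul_eq_mul, var_smul, enorm_mul, mul_div_assoc,
    ← ENNReal.mul_iSup, ← mul_add]

theorem bNorm_zero (U : Set (Fin d → ℂ)) (κ : ℕ → ℝ) :
    bNorm U κ (0 : SFT T → (Fin d → ℂ) → ℂ) = 0 := by
  simpa using bNorm_smul U κ (0 : ℂ) (0 : SFT T → (Fin d → ℂ) → ℂ)

/-- The functions `f(x, z)` on `Σ_T⁺ × U`, extended by zero off `U`, such that `z ↦ f(x, z)` is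
holomorphic on `U`, `x ↦ f(x, z)` is continuous, and the norm is finite. As `U` is a relatively open
subset of an affine hyperplane, `DifferentiableOn ℂ _ U` is holomorphy in the hyperplane. -/
def bSubmodule (T : Matrix (Fin N) (Fin N) ℕ) (U : Set (Fin d → ℂ)) (κ : ℕ → ℝ) :
    Submodule ℂ (SFT T → (Fin d → ℂ) → ℂ) where
  carrier := {f | (∀ x, ∀ z ∉ U, f x z = 0) ∧ (∀ x, DifferentiableOn ℂ (f x) U) ∧
    (∀ z ∈ U, Continuous fun x => f x z) ∧ bNorm U κ f < ∞}
  zero_mem' := ⟨fun _ _ _ => rfl, fun _ => differentiableOn_const 0, fun _ _ => continuous_const,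
    by rw [bNorm_zero]; exact ENNReal.zero_lt_top⟩
  add_mem' := by
    rintro f g ⟨hf0, hf1, hf2, hf3⟩ ⟨hg0, hg1, hg2, hg3⟩
    refine ⟨fun x z hz => ?_, fun x => (hf1 x).add (hg1 x), fun z hz => (hf2 z hz).add (hg2 z hz),
      (bNorm_add_le U κ f g).trans_lt (ENNReal.add_lt_top.2 ⟨hf3, hg3⟩)⟩
    change f x z + g x z = 0
    rw [hf0 x z hz, hg0 x z hz, add_zero]
  smul_mem' := by
    rintro c f ⟨hf0, hf1, hf2, hf3⟩
    refine ⟨fun x z hz => ?_, fun x => (hf1 x).const_smul c, fun z hz => (hf2 z hz).const_smul c, ?_⟩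
    · change c • f x z = 0
      rw [hf0 x z hz, smul_zero]
    · rw [bNorm_smul]
      exact ENNReal.mul_lt_top enorm_lt_top hf3

/-- The space `𝓑(U, κ)`. -/
def BSpace (T : Matrix (Fin N) (Fin N) ℕ) (U : Set (Fin d → ℂ)) (κ : ℕ → ℝ) : Type :=
  bSubmodule T U κ

namespace BSpace

variable {U : Set (Fin d → ℂ)} {κ : ℕ → ℝ}

instance : AddCommGroup (BSpace T U κ) := inferInstanceAs (AddCommGroup (bSubmodule T U κ))

instance : Module ℂ (BSpace T U κ) := inferInstanceAs (Module ℂ (bSubmodule T U κ))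

/-- The function `f(x, z)` given by an element of the space. -/
def toFun (f : BSpace T U κ) : SFT T → (Fin d → ℂ) → ℂ := f.1

instance : Norm (BSpace T U κ) := ⟨fun f => (bNorm U κ f.toFun).toReal⟩

theorem norm_def (f : BSpace T U κ) : ‖f‖ = (bNorm U κ f.toFun).toReal := rfl

theorem normCore : NormedSpace.Core ℂ (BSpace T U κ) where
  norm_nonneg _ := ENNReal.toReal_nonneg
  norm_smul c f := by
    change (bNorm U κ (c • f.toFun)).toReal = ‖c‖ * (bNorm U κ f.toFun).toReal
    rw [bNorm_smul, ENNReal.toReal_mul, toReal_enorm]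
  norm_triangle f g := by
    change (bNorm U κ (f.toFun + g.toFun)).toReal ≤
      (bNorm U κ f.toFun).toReal + (bNorm U κ g.toFun).toReal
    have hf : bNorm U κ f.toFun ≠ ∞ := f.2.2.2.2.ne
    have hg : bNorm U κ g.toFun ≠ ∞ := g.2.2.2.2.ne
    rw [← ENNReal.toReal_add hf hg]
    exact ENNReal.toReal_mono (ENNReal.add_lt_top.2 ⟨f.2.2.2.2, g.2.2.2.2⟩).ne
      (bNorm_add_le U κ _ _)
  norm_eq_zero_iff f := by
    constructor
    · intro h
      have h0 : bNorm U κ f.toFun = 0 :=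
        ((ENNReal.toReal_eq_zero_iff _).1 h).resolve_right f.2.2.2.2.ne
      refine Subtype.ext (funext fun x => funext fun z => ?_)
      by_cases hz : z ∈ U
      · simp only [bNorm, ENNReal.iSup_eq_zero, add_eq_zero] at h0
        exact enorm_eq_zero.1 ((h0 z hz).1 x)
      · exact f.2.1 x z hz
    · rintro rfl
      change (bNorm U κ (0 : SFT T → (Fin d → ℂ) → ℂ)).toReal = 0
      rw [bNorm_zero, ENNReal.toReal_zero]

instance : NormedAddCommGroup (BSpace T U κ) := NormedAddCommGroup.ofCore normCore

instance : NormedSpace ℂ (BSpace T U κ) := NormedSpace.ofCore normCore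

end BSpace

/-! ### The transfer operator -/

/-- `ℓ` is a holomorphic extension to `U` of the logarithm of the norm `ν` on `ℝ^d`, such that the
corresponding extension `exp (-β ℓ)` of `ν ^ (-β)` is bounded on `U`. -/
structure IsLogNorm (U : Set (Fin d → ℂ)) (β : ℝ) (ν : Seminorm ℝ (Fin d → ℝ))
    (ℓ : (Fin d → ℂ) → ℂ) : Prop where
  definite : ∀ u, ν u = 0 → u = 0
  holomorphic : DifferentiableOn ℂ ℓ U
  extends_log : ∀ u : Fin d → ℝ, toC u ∈ U → ℓ (toC u) = (Real.log (ν u) : ℂ)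
  bounded : ∃ R : ℝ, ∀ z ∈ U, ‖Complex.exp (-(β : ℂ) * ℓ z)‖ ≤ R

/-- The analytic continuation to `U` of `u ↦ ν (A (u / ν u)) ^ β`. For real `u` with `⟨u, w⟩ = 1`
this equals `|⟨A u, w⟩| ^ β * (ν (proj w A u) / ν u) ^ β`, as is checked below. For `z ∈ U` the real
part of `⟨A z, w⟩` does not vanish, so that `(⟨A z, w⟩ ^ 2) ^ (β / 2)` (principal branch) is the
analytic continuation of `|⟨A u, w⟩| ^ β`. -/
def weight (w : Fin d → ℝ) (ℓ : (Fin d → ℂ) → ℂ) (β : ℝ) (A : Matrix (Fin d) (Fin d) ℝ)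
    (z : Fin d → ℂ) : ℂ :=
  ((pair (act A z) w) ^ 2) ^ ((β : ℂ) / 2) * Complex.exp ((β : ℂ) * (ℓ (proj w A z) - ℓ z))

/-- The function `𝓛_β f (x, z)`. -/
def transfer (φ : SFT T → ℝ) (A : SFT T → GL (Fin d) ℝ) (w : Fin d → ℝ) (ℓ : (Fin d → ℂ) → ℂ)
    (β : ℝ) (f : SFT T → (Fin d → ℂ) → ℂ) (x : SFT T) (z : Fin d → ℂ) : ℂ :=
  ∑ i : {i : Fin N // T i (x.1 0) = 1},
    Complex.exp (φ (x.cons i)) * weight w ℓ β (A (x.cons i) : Matrix (Fin d) (Fin d) ℝ) z *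
      f (x.cons i) (proj w (A (x.cons i) : Matrix (Fin d) (Fin d) ℝ) z)

/-! ### Approximation numbers -/

/-- The approximation number `a_n(L) = inf {‖L - F‖ : rank F < n}`. -/
def approxNumber {E : Type*} [NormedAddCommGroup E] [NormedSpace ℂ E] (n : ℕ) (L : E →L[ℂ] E) : ℝ :=
  sInf {r : ℝ | ∃ F : E →L[ℂ] E, (F : E →ₗ[ℂ] E).rank < (n : Cardinal) ∧ r = ‖L - F‖}

/-! ### The weight on real vectors -/

theorem act_toC (A : Matrix (Fin d) (Fin d) ℝ) (u : Fin d → ℝ) : act A (toC u) = toC (A *ᵥ u) := by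
  ext k
  simp [act, toC, mulVec, dotProduct]

theorem pair_toC (u w : Fin d → ℝ) : pair (toC u) w = ((u ⬝ᵥ w : ℝ) : ℂ) := by
  simp [pair, toC, dotProduct]

theorem weight_toC {U : Set (Fin d → ℂ)} {β : ℝ} {ν : Seminorm ℝ (Fin d → ℝ)}
    {ℓ : (Fin d → ℂ) → ℂ} (hℓ : IsLogNorm U β ν ℓ) (w : Fin d → ℝ)
    (A : Matrix (Fin d) (Fin d) ℝ) (u : Fin d → ℝ) (hu0 : u ≠ 0) (hA : (A *ᵥ u) ⬝ᵥ w ≠ 0)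
    (hu : toC u ∈ U) (hAu : proj w A (toC u) ∈ U) :
    weight w ℓ β A (toC u) = ((ν (A *ᵥ ((ν u)⁻¹ • u)) ^ β : ℝ) : ℂ) := by
  have pos : ∀ v, v ≠ 0 → 0 < ν v := fun v hv =>
    lt_of_le_of_ne (apply_nonneg ν v) fun h => hv (hℓ.definite v h.symm)
  set t : ℝ := (A *ᵥ u) ⬝ᵥ w with ht
  have hAu0 : A *ᵥ u ≠ 0 := by
    intro h
    exact hA (by rw [ht, h, zero_dotProduct])
  have hproj : proj w A (toC u) = toC (t⁻¹ • (A *ᵥ u)) := by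
    rw [proj, act_toC, pair_toC]
    ext k
    simp [toC, ht]
  have h1 : 0 < ν u := pos u hu0
  have h2 : 0 < ν (A *ᵥ u) := pos _ hAu0
  have ht0 : 0 < |t| := abs_pos.2 hA
  rw [weight, hℓ.extends_log u hu, hproj, hℓ.extends_log _ (hproj ▸ hAu), act_toC, pair_toC, ← ht]
  have e1 : (((t : ℂ)) ^ 2) ^ ((β : ℂ) / 2) = ((Real.exp (β * Real.log |t|) : ℝ) : ℂ) := by
    have : ((t : ℂ)) ^ 2 = ((|t| ^ 2 : ℝ) : ℂ) := by rw [sq_abs]; push_cast; rfl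
    have hb : (β : ℂ) / 2 = ((β / 2 : ℝ) : ℂ) := by push_cast; rfl
    rw [this, hb, ← Complex.ofReal_cpow (by positivity), Real.rpow_def_of_pos (by positivity),
      Real.log_pow]
    congr 2
    push_cast
    ring
  rw [e1, map_smul_eq_mul, mulVec_smul, map_smul_eq_mul, Real.norm_eq_abs, Real.norm_eq_abs,
    abs_inv, abs_inv, abs_of_pos h1, Real.log_mul (by positivity) h2.ne', Real.log_inv,
    Real.rpow_def_of_pos (by positivity), Real.log_mul (by positivity) h2.ne', Real.log_inv,
    ← Complex.ofReal_sub, ← Complex.ofReal_mul, ← Complex.ofReal_exp, ← Complex.ofReal_mul,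
    ← Real.exp_add]
  congr 2
  ring

end FastLyapunov

end

open FastLyapunov

/-!
The transfer operator `L` gains one symbol: a point `ix` agrees with `iy` in `k + 1` symbols if `x`
and `y` agree in `k`. With `κ_n = exp (-c n ^ p)` a gain of one symbol is worth the factor
`κ_n / κ_{n-1} ≤ θ_n := exp (-c p (n - 1) ^ (p - 1))`. Let `Q_n` replace `f(x, ·)` by `f(x_n, ·)`,
where `x_n` represents the cylinder of length `n` of `x`, and replace this holomorphic function by
a finite-rank approximation. The error `f - Q_n f` is of size `κ_n`, its variations of index `k`
are of size `κ_{max k n}`, and therefore `‖L - L Q_n‖ = O(θ_n)` (`sumPreimages_bounds`,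
`exists_finiteRank_approx`, `exists_transfer_approx`). The rank of `L Q_n` is the number of words of
length `n`, hence at most `exp ((h_top + ε) n)` by the definition of the entropy through dynamical
covers (`SFT.eventually_words_le`), times the rank of the approximation in the second variable,
which is polynomial in `n`. Finally `L ^ q - (L - F) ^ q` has rank at most `q * rank F`
(`approxNumber_pow_le`), so that powers need no separate analysis.

Three facts make this work.

* The projective action maps `U` into a compact part `S` of `U`. A point of `U` is given by a pair
  of vectors of a cone, normalized to lie in a compact set, and a matrix of the multicone maps
  such a pair, even on the boundary, to a pair in the interior of a cone, up to a common sign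
  (`IsMulticone.exists_compact_hull`). The same computation shows that the real part of `⟨A z, w⟩`
  does not vanish, so that the weight is holomorphic with rapidly decaying variations
  (`exists_kernel_data`).
* A bounded holomorphic function on `U` that vanishes on a grid of `O(M ^ d)` points is of size
  `2 ^ (-M)` on `S`. On a polydisc this follows by interpolating at the `M`-th roots of unity in one
  variable at a time (`norm_le_of_zero_on_grid`). As only lines parallel to the axes are used, no
  theory of several complex variables is needed.
* The values on such a grid are interpolated by an operator whose norm is linear in the number of
  points: take functions in the unit ball that almost maximize the determinant of the values, and
  use Cramer's rule (`exists_interpolation`). Together the last two facts give a relative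
  error `M ^ d / 2 ^ M` at rank `O(M ^ d)`.
-/

open FastLyapunov
open Filter Topology Uniformity

/-! ### Words and entropy of a shift of finite type -/

namespace FastLyapunov.SFT

variable {N : ℕ} {T : Matrix (Fin N) (Fin N) ℕ}

theorem uniformity_eq : 𝓤 (SFT T) = ⨅ i : ℕ, 𝓟 {q : SFT T × SFT T | q.1.1 i = q.2.1 i} := by
  change Filter.comap _ (@uniformity _ (@Pi.uniformSpace ℕ (fun _ => Fin N) fun _ => ⊥)) = _
  rw [@Pi.uniformity ℕ (fun _ => Fin N) (fun _ => ⊥), Filter.comap_iInf]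
  refine iInf_congr fun i => ?_
  rw [Filter.comap_comap]
  have : @uniformity (Fin N) ⊥ = 𝓟 SetRel.id := rfl
  rw [this, Filter.comap_principal]
  rfl

/-- Agreement of the first `n` symbols is a basis of entourages. -/
theorem hasBasis_uniformity :
    (𝓤 (SFT T)).HasBasis (fun _ : ℕ => True)
      fun n => {q : SFT T × SFT T | ∀ i < n, q.1.1 i = q.2.1 i} := by
  rw [uniformity_eq]
  refine (Filter.hasBasis_iInf_principal_finite _).to_hasBasis ?_ ?_
  · intro t ht
    obtain ⟨n, hn⟩ := ht.bddAbove
    refine ⟨n + 1, trivial, fun q hq => mem_iInter₂.2 fun i hi => hq i ?_⟩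
    exact Nat.lt_succ_of_le (hn hi)
  · intro n _
    exact ⟨Set.Iio n, Set.finite_Iio n, fun q hq i hi => mem_iInter₂.1 hq i hi⟩

instance : CompactSpace (SFT T) := by
  let _ : TopologicalSpace (Fin N) := ⊥
  have : DiscreteTopology (Fin N) := ⟨rfl⟩
  have hind : IsInducing (fun x : SFT T => x.1) := ⟨rfl⟩
  have hr : range (fun x : SFT T => x.1) =
      ⋂ i, {x : ℕ → Fin N | T (x i) (x (i + 1)) = 1} := by
    ext x
    simp only [mem_range, mem_iInter, mem_ofPred_eq]
    exact ⟨by rintro ⟨y, rfl⟩; exact y.2, fun h => ⟨⟨x, h⟩, rfl⟩⟩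
  have hc : IsClosed (range fun x : SFT T => x.1) := by
    rw [hr]
    refine isClosed_iInter fun i => ?_
    have : Continuous fun x : ℕ → Fin N => (x i, x (i + 1)) := by fun_prop
    exact (isClosed_discrete {q : Fin N × Fin N | T q.1 q.2 = 1}).preimage this
  exact ⟨(hind.isCompact_iff).2 (by rw [image_univ]; exact hc.isCompact)⟩

theorem continuous_of_var_tendsto {V : Type*} [PseudoMetricSpace V] {f : SFT T → V} {b : ℕ → ℝ}
    (hb : Tendsto b atTop (𝓝 0))
    (h : ∀ k, 1 ≤ k → ∀ x y : SFT T, (∀ i < k, x.1 i = y.1 i) → dist (f x) (f y) ≤ b k) :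
    Continuous f := by
  refine continuous_iff_continuousAt.2 fun x => Metric.tendsto_nhds.2 fun ε hε => ?_
  obtain ⟨k, hk, hk1⟩ := ((hb.eventually (gt_mem_nhds hε)).and (eventually_ge_atTop 1)).exists
  refine Filter.mem_of_superset ((nhds_basis_uniformity'
    hasBasis_uniformity (x := x)).mem_of_mem (i := k) trivial) fun y hy => ?_
  exact (h k hk1 y x fun i hi => (hy i hi).symm).trans_lt hk

/-- The words of length `n` that occur at the start of a point of the shift. -/
def words (T : Matrix (Fin N) (Fin N) ℕ) (n : ℕ) : Set (Fin n → Fin N) :=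
  range fun (x : SFT T) (i : Fin n) => x.1 i

theorem shift_iterate (k i : ℕ) (x : SFT T) : (shift^[k] x).1 i = x.1 (i + k) := by
  induction k generalizing x with
  | zero => rfl
  | succ k ih =>
    rw [Function.iterate_succ_apply, ih]
    rfl

theorem words_ncard_le (n : ℕ) : (words T n).ncard ≤ N ^ n := by
  refine (Set.ncard_le_ncard (subset_univ _)).trans ?_
  simp [Set.ncard_univ]

theorem words_le_card {n : ℕ} {s : Finset (SFT T)}
    (h : Dynamics.IsDynCoverOf (shift : SFT T → SFT T) univ {q | ∀ i < 1, q.1.1 i = q.2.1 i} n s) :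
    (words T n).ncard ≤ s.card := by
  have : words T n ⊆ (fun (x : SFT T) (i : Fin n) => x.1 i) '' s := by
    rintro _ ⟨x, rfl⟩
    obtain ⟨y, hy, hxy⟩ := h (mem_univ x)
    refine ⟨y, hy, funext fun i => ?_⟩
    have := Dynamics.mem_dynEntourage.1 hxy i i.2 0 one_pos
    simpa [shift_iterate] using this.symm
  calc (words T n).ncard ≤ _ := Set.ncard_le_ncard this
    _ ≤ (s : Set (SFT T)).ncard := Set.ncard_image_le s.finite_toSet
    _ = s.card := Set.ncard_coe_finset s

theorem coverMincard_le (k n : ℕ) :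
    Dynamics.coverMincard (shift : SFT T → SFT T) univ {q | ∀ i < k, q.1.1 i = q.2.1 i} n ≤
      (words T (n + k)).ncard := by
  choose g hg using fun c : words T (n + k) => c.2
  have hfin : (range g).Finite := Set.finite_range g
  have hcov : Dynamics.IsDynCoverOf (shift : SFT T → SFT T) univ
      {q | ∀ i < k, q.1.1 i = q.2.1 i} n hfin.toFinset := by
    intro x _
    refine ⟨g ⟨_, ⟨x, rfl⟩⟩, by simp, Dynamics.mem_dynEntourage.2 fun j hj i hi => ?_⟩
    have := congrFun (hg ⟨_, ⟨x, rfl⟩⟩) ⟨i + j, by omega⟩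
    simpa [shift_iterate] using this.symm
  refine hcov.coverMincard_le_card.trans ?_
  rw [← Set.ncard_eq_toFinset_card _ hfin]
  have : (range g).ncard ≤ (words T (n + k)).ncard := by
    rw [← image_univ]
    refine (Set.ncard_image_le finite_univ).trans ?_
    rw [Set.ncard_univ]
    exact le_of_eq (Nat.card_coe_set_eq _)
  exact_mod_cast this

theorem coverEntropy_ne_top :
    Dynamics.coverEntropy (shift : SFT T → SFT T) univ ≠ ⊤ := by
  refine ne_top_of_le_ne_top (b := ENNReal.log N) ?_ ?_
  · rw [Ne, ENNReal.log_eq_top_iff]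
    exact ENNReal.natCast_ne_top N
  rw [Dynamics.coverEntropy_eq_iSup_basis hasBasis_uniformity]
  refine iSup₂_le fun k _ => ?_
  rw [← ExpGrowth.expGrowthSup_pow]
  refine ExpGrowth.expGrowthSup_le_of_eventually_le (b := (N : ℝ≥0∞) ^ k) (by finiteness)
    (Eventually.of_forall fun n => ?_)
  have h := (coverMincard_le (T := T) k n).trans
    (Nat.cast_le.2 (words_ncard_le (T := T) (n + k)))
  have h2 := ENat.toENNReal_mono h
  simp only [Nat.cast_pow, ENat.toENNReal_pow, ENat.toENNReal_coe] at h2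
  rwa [pow_add, mul_comm] at h2

theorem entropy_nonneg [Nonempty (SFT T)] : 0 ≤ entropy T :=
  EReal.toReal_nonneg (Dynamics.coverEntropy_nonneg _ univ_nonempty)

/-- The number of words grows at most at the exponential rate given by the entropy: the cylinders
of length `n` are the dynamical balls of the entourage of pairs with the same first symbol. -/
theorem eventually_words_le [Nonempty (SFT T)] {ε : ℝ} (hε : 0 < ε) :
    ∀ᶠ n : ℕ in atTop, ((words T n).ncard : ℝ) ≤ Real.exp ((entropy T + ε) * n) := by
  set V : SetRel (SFT T) (SFT T) := {q | ∀ i < 1, q.1.1 i = q.2.1 i} with hV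
  have hle : Dynamics.coverEntropyEntourage (shift : SFT T → SFT T) univ V ≤
      ((entropy T : ℝ) : EReal) := by
    rw [entropy, EReal.coe_toReal coverEntropy_ne_top]
    · exact Dynamics.coverEntropyEntourage_le_coverEntropy _ _
        (hasBasis_uniformity.mem_of_mem trivial)
    · exact ne_bot_of_le_ne_bot (by simp) (Dynamics.coverEntropy_nonneg _ univ_nonempty)
  have hlt : Dynamics.coverEntropyEntourage (shift : SFT T → SFT T) univ V <
      ((entropy T + ε : ℝ) : EReal) :=
    hle.trans_lt (EReal.coe_lt_coe_iff.2 (by linarith))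
  filter_upwards [ExpGrowth.eventually_le_exp hlt] with n hn
  have hfin : Dynamics.coverMincard (shift : SFT T → SFT T) univ V n < ⊤ :=
    (coverMincard_le 1 n).trans_lt (ENat.natCast_lt_top _)
  obtain ⟨s, hs, hsc⟩ := (Dynamics.coverMincard_finite_iff _ _ _ _).1 hfin
  rw [← hsc] at hn
  have h1 : ((words T n).ncard : ℝ) ≤ s.card := by exact_mod_cast words_le_card hs
  refine h1.trans ?_
  have e : (((entropy T + ε : ℝ) : EReal) * (n : EReal)) = (((entropy T + ε) * n : ℝ) : EReal) := by
    push_cast; rfl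
  rw [e, EReal.exp_coe, ENat.toENNReal_coe] at hn
  rw [← ENNReal.ofReal_natCast] at hn
  exact (ENNReal.ofReal_le_ofReal_iff (Real.exp_pos _).le).1 hn

end FastLyapunov.SFT

/-! ### Interpolation with well-conditioned dual functionals -/

namespace FastLyapunov

/-- The values of a surjective bounded map to `ℂ ^ r` are interpolated by vectors of the unit ball
with coefficient functionals of norm at most `2`: the vectors almost maximize a determinant over the
unit ball, and the functionals are given by Cramer's rule. -/
theorem exists_interpolation_of_surjective {V : Type*} [NormedAddCommGroup V] [NormedSpace ℂ V]
    {r : ℕ} (Λ : V →L[ℂ] (Fin r → ℂ)) (hΛ : Function.Surjective Λ) :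
    ∃ (f : Fin r → V) (μ : Fin r → V →L[ℂ] ℂ), (∀ j, ‖f j‖ ≤ 1) ∧
      (∀ j g, ‖μ j g‖ ≤ 2 * ‖g‖) ∧ ∀ g, Λ (∑ j, μ j g • f j) = Λ g := by
  classical
  let D : V [⋀^Fin r]→ₗ[ℂ] ℂ := Matrix.detRowAlternating.compLinearMap (Λ : V →ₗ[ℂ] (Fin r → ℂ))
  have hD : ∀ f : Fin r → V, D f = Matrix.det (Matrix.of fun j => Λ (f j)) := fun f => rfl
  set S : Set ℝ := {t | ∃ f : Fin r → V, (∀ j, ‖f j‖ ≤ 1) ∧ t = ‖D f‖} with hS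
  have hbdd : BddAbove S := by
    refine ⟨(Nat.factorial (Fintype.card (Fin r))) • ‖Λ‖ ^ Fintype.card (Fin r), ?_⟩
    rintro _ ⟨f, hf, rfl⟩
    rw [hD]
    refine Matrix.det_le (abv := NormedField.toAbsoluteValue ℂ) fun i j => ?_
    change ‖Λ (f i) j‖ ≤ ‖Λ‖
    calc ‖Λ (f i) j‖ ≤ ‖Λ (f i)‖ := norm_le_pi_norm _ _
      _ ≤ ‖Λ‖ * ‖f i‖ := Λ.le_opNorm _
      _ ≤ ‖Λ‖ * 1 := by gcongr; exact hf i
      _ = ‖Λ‖ := mul_one _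
  have hpos : ∃ t ∈ S, 0 < t := by
    choose g hg using fun j : Fin r => hΛ (Pi.single j 1)
    refine ⟨_, ⟨fun j => ((1 + ‖g j‖ : ℝ) : ℂ)⁻¹ • g j, fun j => ?_, rfl⟩, ?_⟩
    · rw [norm_smul, norm_inv, Complex.norm_real, Real.norm_eq_abs,
        abs_of_pos (by positivity : 0 < 1 + ‖g j‖), inv_mul_le_iff₀ (by positivity)]
      linarith
    · have h1 : D g = 1 := by
        rw [hD]
        have : (Matrix.of fun j => Λ (g j)) = (1 : Matrix (Fin r) (Fin r) ℂ) := by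
          ext i j
          simp [hg, Matrix.one_apply, Pi.single_apply, eq_comm]
        rw [this, Matrix.det_one]
      rw [D.map_smul_univ, h1, norm_pos_iff]
      refine smul_ne_zero (Finset.prod_ne_zero_iff.2 fun j _ => inv_ne_zero ?_) one_ne_zero
      exact Complex.ofReal_ne_zero.2 (by positivity)
  obtain ⟨t, ht, htpos⟩ := hpos
  have hsup : 0 < sSup S := htpos.trans_le (le_csSup hbdd ht)
  obtain ⟨_, ⟨f, hf, rfl⟩, hlt⟩ := exists_lt_of_lt_csSup ⟨t, ht⟩ (half_lt_self hsup)
  have hDf : 0 < ‖D f‖ := (half_pos hsup).trans hlt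
  have hDf0 : D f ≠ 0 := norm_pos_iff.1 hDf
  have hmax : ∀ j g, ‖D (Function.update f j g)‖ ≤ 2 * ‖D f‖ * ‖g‖ := by
    intro j g
    rcases eq_or_ne g 0 with rfl | hg
    · simp
    have hg' : 0 < ‖g‖ := norm_pos_iff.2 hg
    have hmem : ‖D (Function.update f j (((‖g‖ : ℝ) : ℂ)⁻¹ • g))‖ ∈ S := by
      refine ⟨_, fun i => ?_, rfl⟩
      rcases eq_or_ne i j with rfl | hij
      · rw [Function.update_self, norm_smul, norm_inv, Complex.norm_real, norm_norm,
          inv_mul_cancel₀ hg'.ne']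
      · rw [Function.update_of_ne hij]
        exact hf i
    have h2 := (le_csSup hbdd hmem)
    rw [D.map_update_smul, norm_smul, norm_inv, Complex.norm_real, norm_norm,
      inv_mul_le_iff₀ hg'] at h2
    nlinarith
  refine ⟨f, fun j => LinearMap.mkContinuous
    ((D f)⁻¹ • (D.toMultilinearMap.toLinearMap f j)) 2 fun g => ?_, hf, fun j g => ?_, fun g => ?_⟩
  · change ‖(D f)⁻¹ * D (Function.update f j g)‖ ≤ _
    rw [norm_mul, norm_inv, inv_mul_le_iff₀ hDf]
    linarith [hmax j g]
  · change ‖(D f)⁻¹ * D (Function.update f j g)‖ ≤ _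
    rw [norm_mul, norm_inv, inv_mul_le_iff₀ hDf]
    linarith [hmax j g]
  · set B : Matrix (Fin r) (Fin r) ℂ := Matrix.of fun j => Λ (f j) with hB
    have hup : ∀ j, D (Function.update f j g) = (B.updateRow j (Λ g)).det := by
      intro j
      rw [hD]
      congr 1
      ext i k
      rcases eq_or_ne i j with rfl | hij
      · simp
      · simp [Function.update_of_ne hij, hB, Matrix.updateRow_ne hij]
    have hcr := Matrix.mulVec_cramer Bᵀ (Λ g)
    rw [Matrix.det_transpose] at hcr
    have hDB : D f = B.det := hD f
    rw [map_sum]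
    ext k
    have hk := congrFun hcr k
    simp only [Matrix.mulVec, dotProduct, Matrix.transpose_apply, Matrix.cramer_transpose_apply,
      Pi.smul_apply, smul_eq_mul] at hk
    rw [Finset.sum_apply]
    simp only [map_smul, Pi.smul_apply, smul_eq_mul]
    change ∑ j, ((D f)⁻¹ * D (Function.update f j g)) * Λ (f j) k = _
    rw [← mul_right_inj' hDf0, Finset.mul_sum, hDB, ← hk]
    refine Finset.sum_congr rfl fun j _ => ?_
    rw [hup, ← hDB, ← mul_assoc, mul_inv_cancel_left₀ hDf0, mul_comm]
    rfl

/-- The version of `exists_interpolation_of_surjective` for an arbitrary bounded map `Λ` to a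
finite-dimensional space: pass to the range of `Λ`. -/
theorem exists_interpolation {V ι : Type*} [NormedAddCommGroup V] [NormedSpace ℂ V] [Fintype ι]
    (Λ : V →L[ℂ] (ι → ℂ)) :
    ∃ (r : ℕ) (f : Fin r → V) (μ : Fin r → V →L[ℂ] ℂ), r ≤ Fintype.card ι ∧ (∀ j, ‖f j‖ ≤ 1) ∧
      (∀ j g, ‖μ j g‖ ≤ 2 * ‖g‖) ∧ ∀ g, Λ (∑ j, μ j g • f j) = Λ g := by
  let R := LinearMap.range (Λ : V →ₗ[ℂ] (ι → ℂ))
  let e : R ≃L[ℂ] (Fin (Module.finrank ℂ R) → ℂ) :=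
    (Module.finBasis ℂ R).equivFun.toContinuousLinearEquiv
  let Λ₁ : V →L[ℂ] R := Λ.codRestrict R fun v => ⟨v, rfl⟩
  have hs : Function.Surjective ((e : R →L[ℂ] (Fin (Module.finrank ℂ R) → ℂ)).comp Λ₁) := by
    refine e.surjective.comp ?_
    rintro ⟨_, v, rfl⟩
    exact ⟨v, rfl⟩
  obtain ⟨f, μ, hf, hμ, h⟩ := exists_interpolation_of_surjective _ hs
  refine ⟨_, f, μ, ?_, hf, hμ, fun g => ?_⟩
  · exact (Submodule.finrank_le R).trans_eq (by simp)
  · exact congrArg Subtype.val (e.injective (h g))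

end FastLyapunov

/-! ### Holomorphic functions with zeros on a grid of roots of unity -/

namespace FastLyapunov

open Polynomial in
/-- The Lebesgue constant of interpolation at the `M`-th roots of unity is at most `2 ^ M`. -/
theorem norm_eval_le_of_roots_of_unity {M : ℕ} (hM : 0 < M) {p : ℂ[X]} (hp : p.degree < M) {η : ℝ}
    (h : ∀ ω : ℂ, ω ^ M = 1 → ‖p.eval ω‖ ≤ η) {t : ℂ} (ht : ‖t‖ ≤ 1) :
    ‖p.eval t‖ ≤ 2 ^ M * η := by
  classical
  have hM0 : (M : ℂ) ≠ 0 := Nat.cast_ne_zero.2 hM.ne'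
  have hprim := Complex.isPrimitiveRoot_exp M hM.ne'
  set s := nthRootsFinset M (1 : ℂ) with hs
  have hcard : s.card = M := hprim.card_nthRootsFinset
  have hmem : ∀ ω ∈ s, ω ^ M = 1 := fun ω hω => (mem_nthRootsFinset hM (1 : ℂ)).1 hω
  have hnorm : ∀ ω ∈ s, ‖ω‖ = 1 := fun ω hω => Complex.norm_eq_one_of_pow_eq_one (hmem ω hω) hM.ne'
  have hη : 0 ≤ η := (norm_nonneg _).trans (h 1 (one_pow M))
  have hnodal : Lagrange.nodal s (id : ℂ → ℂ) = X ^ M - 1 := by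
    rw [X_pow_sub_one_eq_prod hM hprim]
    rfl
  have hden : ∀ ω ∈ s, ‖∏ τ ∈ s.erase ω, (ω - τ)‖ = M := by
    intro ω hω
    have h1 := Lagrange.eval_nodal_derivative_eval_node_eq (v := (id : ℂ → ℂ)) hω
    rw [hnodal, Lagrange.eval_nodal] at h1
    simp only [id] at h1
    rw [← h1]
    simp [Polynomial.derivative_X_pow, hnorm ω hω]
  have hbasis : ∀ ω ∈ s, ‖(Lagrange.basis s id ω).eval t‖ ≤ 2 ^ M / M := by
    intro ω hω
    have h1 : (Lagrange.basis s (id : ℂ → ℂ) ω).eval t =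
        (∏ τ ∈ s.erase ω, (ω - τ))⁻¹ * ∏ τ ∈ s.erase ω, (t - τ) := by
      rw [Lagrange.basis, eval_prod, ← Finset.prod_inv_distrib, ← Finset.prod_mul_distrib]
      refine Finset.prod_congr rfl fun τ _ => ?_
      simp [Lagrange.basisDivisor]
    rw [h1, norm_mul, norm_inv, hden ω hω, inv_mul_eq_div]
    gcongr
    rw [norm_prod]
    calc ∏ τ ∈ s.erase ω, ‖t - τ‖ ≤ ∏ τ ∈ s.erase ω, (2 : ℝ) := by
          refine Finset.prod_le_prod (fun _ _ => norm_nonneg _) fun τ hτ => ?_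
          have := norm_sub_le t τ
          have := hnorm τ (Finset.mem_of_mem_erase hτ)
          linarith
      _ = 2 ^ (s.erase ω).card := by rw [Finset.prod_const]
      _ ≤ 2 ^ M := by
          refine pow_le_pow_right₀ one_le_two ?_
          rw [← hcard]
          exact Finset.card_le_card (Finset.erase_subset _ _)
  have hint := Lagrange.eq_interpolate (s := s) (v := (id : ℂ → ℂ)) (f := p)
    (fun _ _ _ _ h => h) (by rwa [hcard])
  rw [hint, Lagrange.interpolate_apply, eval_finsetSum]
  calc ‖∑ ω ∈ s, (C (p.eval (id ω)) * Lagrange.basis s id ω).eval t‖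
      ≤ ∑ ω ∈ s, η * (2 ^ M / M) := by
        refine norm_sum_le_of_le _ fun ω hω => ?_
        rw [eval_mul, eval_C, norm_mul]
        exact mul_le_mul (h ω (hmem ω hω)) (hbasis ω hω) (norm_nonneg _) hη
    _ = 2 ^ M * η := by
        have : (M : ℝ) ≠ 0 := Nat.cast_ne_zero.2 hM.ne'
        rw [Finset.sum_const, hcard, nsmul_eq_mul]
        field_simp

/-- A function that is holomorphic on a large disc and small at the `M`-th roots of unity is small
on the unit disc. -/
theorem norm_le_of_small_at_roots_of_unity {f : ℂ → ℂ} {R B η : ℝ} {M : ℕ} (hM : 0 < M)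
    (hR : 2 ≤ R) (hf : DifferentiableOn ℂ f (Metric.closedBall 0 R))
    (hB : ∀ t, ‖t‖ ≤ R → ‖f t‖ ≤ B) (hη : ∀ ω : ℂ, ω ^ M = 1 → ‖f ω‖ ≤ η) {t : ℂ} (ht : ‖t‖ ≤ 1) :
    ‖f t‖ ≤ 2 ^ M * (η + 4 * B / R ^ M) := by
  have hR0 : 0 < R := by linarith
  have hB0 : 0 ≤ B := (norm_nonneg _).trans (hB 0 (by simpa using hR0.le))
  lift R to ℝ≥0 using hR0.le
  -- The Taylor polynomial `p` of degree `< M` differs from `f` by at most `2 B / R ^ M` on the unit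
  -- disc, and is controlled there by its values at the roots of unity.
  have hser := hf.hasFPowerSeriesOnBall (by exact_mod_cast hR0)
  set P := cauchyPowerSeries f 0 R with hP
  have hcoef : ∀ n, ‖P n‖ ≤ B * ((R : ℝ)⁻¹) ^ n := by
    intro n
    refine (norm_cauchyPowerSeries_le f 0 R n).trans ?_
    rw [abs_of_pos hR0]
    gcongr
    have : ‖∫ θ in (0 : ℝ)..2 * Real.pi, ‖f (circleMap 0 R θ)‖‖ ≤ B * |2 * Real.pi - 0| := by
      refine intervalIntegral.norm_integral_le_of_norm_le_const fun θ _ => ?_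
      rw [norm_norm]
      refine hB _ ?_
      simp
    rw [Real.norm_eq_abs, sub_zero, abs_of_pos Real.two_pi_pos] at this
    rw [inv_mul_le_iff₀ Real.two_pi_pos]
    linarith [le_abs_self (∫ θ in (0 : ℝ)..2 * Real.pi, ‖f (circleMap 0 R θ)‖)]
  let p : Polynomial ℂ := ∑ k ∈ Finset.range M, Polynomial.C (P.coeff k) * Polynomial.X ^ k
  have hpdeg : p.degree < M := by
    refine (Polynomial.degree_sum_le _ _).trans_lt ((Finset.sup_lt_iff ?_).2 fun k hk => ?_)
    · exact WithBot.bot_lt_coe M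
    · exact (Polynomial.degree_C_mul_X_pow_le k _).trans_lt
        (by exact_mod_cast Finset.mem_range.1 hk)
  have htail : ∀ t : ℂ, ‖t‖ ≤ 1 → ‖p.eval t - f t‖ ≤ 2 * B / (R : ℝ) ^ M := by
    intro t ht
    have hmem : t ∈ Metric.eball (0 : ℂ) R := by
      have h1 : ‖t‖ < R := by linarith
      rw [Metric.mem_eball, edist_zero_right, enorm_eq_nnnorm]
      exact_mod_cast h1
    have hsum := hser.hasSum hmem
    rw [zero_add] at hsum
    have hterm : ∀ n, ‖(P n fun _ => t)‖ ≤ B * ((R : ℝ)⁻¹) ^ n := by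
      intro n
      refine ((P n).le_opNorm _).trans ?_
      have : ∏ _i : Fin n, ‖t‖ ≤ 1 := by
        rw [Finset.prod_const]
        exact pow_le_one₀ (norm_nonneg _) ht
      calc ‖P n‖ * ∏ _i : Fin n, ‖t‖ ≤ ‖P n‖ * 1 := by gcongr
        _ ≤ _ := by rw [mul_one]; exact hcoef n
    have hinv : (R : ℝ)⁻¹ ≤ 1 / 2 := by
      rw [one_div]
      exact inv_anti₀ two_pos hR
    have := norm_sub_le_of_geometric_bound_of_hasSum (by linarith) hterm hsum M
    have hp : p.eval t = ∑ k ∈ Finset.range M, (P k fun _ => t) := by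
      rw [Polynomial.eval_finsetSum]
      refine Finset.sum_congr rfl fun k _ => ?_
      rw [FormalMultilinearSeries.apply_eq_pow_smul_coeff]
      rw [Polynomial.eval_mul, Polynomial.eval_C, Polynomial.eval_pow, Polynomial.eval_X,
        smul_eq_mul, mul_comm]
    rw [hp]
    refine this.trans ?_
    rw [div_le_iff₀ (by linarith), inv_pow, div_eq_mul_inv]
    have h3 : 0 ≤ B * ((R : ℝ) ^ M)⁻¹ := by positivity
    nlinarith
  have hroot : ∀ ω : ℂ, ω ^ M = 1 → ‖p.eval ω‖ ≤ η + 2 * B / (R : ℝ) ^ M := by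
    intro ω hω
    have h1 := htail ω (Complex.norm_eq_one_of_pow_eq_one hω hM.ne').le
    have h2 := norm_add_le (f ω) (p.eval ω - f ω)
    rw [add_sub_cancel] at h2
    linarith [hη ω hω]
  have h1 := norm_eval_le_of_roots_of_unity hM hpdeg hroot ht
  have h2 := norm_sub_le (p.eval t) (p.eval t - f t)
  rw [sub_sub_cancel] at h2
  have h3 := htail t ht
  have h4 : (1 : ℝ) ≤ 2 ^ M := one_le_pow₀ one_le_two
  have h5 : 0 ≤ 2 * B / (R : ℝ) ^ M := by positivity
  have h6 : 4 * B / (R : ℝ) ^ M = 2 * B / (R : ℝ) ^ M + 2 * B / (R : ℝ) ^ M := by ring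
  rw [h6]
  nlinarith

/-- A function of several variables that is holomorphic on a large polydisc and vanishes on the
grid of `M`-th roots of unity is of size `2 ^ (-M)` on the small polydisc. The variables
are released from the grid one at a time. -/
theorem norm_le_of_zero_on_grid {ι : Type*} [Fintype ι] {F : (ι → ℂ) → ℂ} {a : ι → ℂ} {ρ B : ℝ}
    {M : ℕ} (hM : 0 < M) (hρ : 0 < ρ)
    (hF : DifferentiableOn ℂ F (Metric.closedBall a (2 ^ (Fintype.card ι + 1) * ρ)))
    (hB : ∀ z ∈ Metric.closedBall a (2 ^ (Fintype.card ι + 1) * ρ), ‖F z‖ ≤ B)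
    (h0 : ∀ ω : ι → ℂ, (∀ i, ω i ^ M = 1) → F (a + (ρ : ℂ) • ω) = 0) {z : ι → ℂ}
    (hz : z ∈ Metric.closedBall a ρ) :
    ‖F z‖ ≤ 4 * B * Fintype.card ι / 2 ^ M := by
  classical
  set R : ℝ := 2 ^ (Fintype.card ι + 1) with hR
  have hR2 : 2 ≤ R := by
    rw [hR, pow_succ]
    have : (1 : ℝ) ≤ 2 ^ Fintype.card ι := one_le_pow₀ one_le_two
    linarith
  have hR0 : 0 < R := by linarith
  have hB0 : 0 ≤ B := (norm_nonneg _).trans (hB a (Metric.mem_closedBall_self (by positivity)))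
  have hmem : ∀ ω : ι → ℂ, (∀ i, ‖ω i‖ ≤ R) → a + (ρ : ℂ) • ω ∈ Metric.closedBall a (R * ρ) := by
    intro ω hω
    rw [mem_closedBall_iff_norm, add_sub_cancel_left, norm_smul, Complex.norm_real,
      Real.norm_eq_abs, abs_of_pos hρ, mul_comm]
    exact mul_le_mul_of_nonneg_right ((pi_norm_le_iff_of_nonneg hR0.le).2 hω) hρ.le
  -- The variables in `s` range over the unit disc, the other ones over the roots of unity.
  have key : ∀ s : Finset ι, ∀ ω : ι → ℂ, (∀ i, ‖ω i‖ ≤ 1) → (∀ i ∉ s, ω i ^ M = 1) →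
      ‖F (a + (ρ : ℂ) • ω)‖ ≤ 4 * B * s.card * (2 ^ M) ^ s.card / R ^ M := by
    intro s
    induction s using Finset.induction_on with
    | empty =>
      intro ω _ hω
      rw [h0 ω fun i => hω i (Finset.notMem_empty i)]
      simp
    | insert i s hi ih =>
      intro ω hω1 hωs
      have hle : ∀ t : ℂ, ‖t‖ ≤ R → ∀ j, ‖Function.update ω i t j‖ ≤ R := by
        intro t ht j
        rcases eq_or_ne j i with rfl | hj
        · simpa using ht
        · rw [Function.update_of_ne hj]
          linarith [hω1 j]
      have hd : DifferentiableOn ℂ (fun t : ℂ => F (a + (ρ : ℂ) • Function.update ω i t))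
          (Metric.closedBall 0 R) := by
        have hu : Differentiable ℂ fun t : ℂ => Function.update ω i t := by
          refine differentiable_pi.2 fun j => ?_
          rcases eq_or_ne j i with rfl | hj
          · simp
          · simp [Function.update_of_ne hj]
        exact hF.comp ((hu.const_smul (ρ : ℂ)).const_add a).differentiableOn fun t ht =>
          hmem _ (hle t (by simpa using ht))
      have := norm_le_of_small_at_roots_of_unity hM hR2 hd
        (fun t ht => hB _ (hmem _ (hle t ht)))
        (η := 4 * B * s.card * (2 ^ M) ^ s.card / R ^ M) (fun τ hτ => ?_) (hω1 i)
      · rw [Function.update_eq_self] at this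
        refine this.trans ?_
        rw [Finset.card_insert_of_notMem hi, ← add_div, mul_div_assoc']
        refine div_le_div_of_nonneg_right ?_ (by positivity)
        have h1 : (1 : ℝ) ≤ (2 ^ M) ^ s.card := one_le_pow₀ (one_le_pow₀ one_le_two)
        have h2 : (0 : ℝ) < 2 ^ M := by positivity
        push_cast
        rw [pow_succ]
        have h3 : 0 ≤ 4 * B * (2 ^ M : ℝ) := by positivity
        nlinarith
      · refine ih _ (fun j => ?_) fun j hj => ?_
        · rcases eq_or_ne j i with rfl | hji
          · simp [Complex.norm_eq_one_of_pow_eq_one hτ hM.ne']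
          · rw [Function.update_of_ne hji]
            exact hω1 j
        · rcases eq_or_ne j i with rfl | hji
          · simpa using hτ
          · rw [Function.update_of_ne hji]
            exact hωs j (by simp [hji, hj])
  have hz' : z = a + (ρ : ℂ) • ((ρ : ℂ)⁻¹ • (z - a)) := by
    rw [smul_inv_smul₀ (Complex.ofReal_ne_zero.2 hρ.ne'), add_sub_cancel]
  have := key Finset.univ ((ρ : ℂ)⁻¹ • (z - a)) (fun i => ?_)
    (fun i hi => absurd (Finset.mem_univ i) hi)
  · rw [← hz', Finset.card_univ] at this
    refine this.trans_eq ?_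
    rw [hR, pow_succ, mul_pow, ← pow_mul, ← pow_mul, mul_comm M]
    field_simp
  · rw [Pi.smul_apply, norm_smul, norm_inv, Complex.norm_real, Real.norm_eq_abs, abs_of_pos hρ,
      inv_mul_le_iff₀ hρ, mul_one]
    exact (norm_le_pi_norm (z - a) i).trans (mem_closedBall_iff_norm.1 hz)

end FastLyapunov

/-! ### Geometry of multicones and of their complexifications -/

namespace FastLyapunov

variable {d m : ℕ}

theorem pair_add (z z' : Fin d → ℂ) (w : Fin d → ℝ) : pair (z + z') w = pair z w + pair z' w :=
  add_dotProduct _ _ _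

theorem pair_smul (c : ℂ) (z : Fin d → ℂ) (w : Fin d → ℝ) : pair (c • z) w = c * pair z w :=
  smul_dotProduct _ _ _

theorem act_smul (A : Matrix (Fin d) (Fin d) ℝ) (c : ℂ) (z : Fin d → ℂ) :
    act A (c • z) = c • act A z :=
  mulVec_smul _ _ _

theorem act_add (A : Matrix (Fin d) (Fin d) ℝ) (z z' : Fin d → ℂ) :
    act A (z + z') = act A z + act A z' :=
  mulVec_add _ _ _

theorem pair_proj {A : Matrix (Fin d) (Fin d) ℝ} {z : Fin d → ℂ} {w : Fin d → ℝ}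
    (h : pair (act A z) w ≠ 0) : pair (proj w A z) w = 1 := by
  rw [proj, pair_smul, inv_mul_cancel₀ h]

theorem pair_of_mem_domain {K : Fin m → Set (Fin d → ℝ)} {w : Fin d → ℝ} {z : Fin d → ℂ}
    (hz : z ∈ domain K w) : pair z w = 1 := by
  obtain ⟨j, hj⟩ := mem_iUnion.1 hz
  exact hj.1

theorem continuous_pair (w : Fin d → ℝ) : Continuous fun z : Fin d → ℂ => pair z w := by
  unfold pair dotProduct
  fun_prop

/-- The complex vector `(u + v) + i (u - v)`. -/
def complexify (u v : Fin d → ℝ) : Fin d → ℂ := toC (u + v) + Complex.I • toC (u - v)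

theorem toC_add (u v : Fin d → ℝ) : toC (u + v) = toC u + toC v := by
  ext k; simp [toC]

theorem toC_sub (u v : Fin d → ℝ) : toC (u - v) = toC u - toC v := by
  ext k; simp [toC]

theorem toC_smul (r : ℝ) (u : Fin d → ℝ) : toC (r • u) = (r : ℂ) • toC u := by
  ext k; simp [toC]

theorem pair_complexify (u v w : Fin d → ℝ) :
    pair (complexify u v) w =
      ((u ⬝ᵥ w + v ⬝ᵥ w : ℝ) : ℂ) + Complex.I * ((u ⬝ᵥ w - v ⬝ᵥ w : ℝ) : ℂ) := by
  rw [complexify, pair_add, pair_smul, pair_toC, pair_toC, add_dotProduct, sub_dotProduct]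

theorem act_complexify (A : Matrix (Fin d) (Fin d) ℝ) (u v : Fin d → ℝ) :
    act A (complexify u v) = complexify (A *ᵥ u) (A *ᵥ v) := by
  rw [complexify, act_add, act_smul, act_toC, act_toC, mulVec_add, mulVec_sub, complexify]

theorem complexify_smul (r : ℝ) (u v : Fin d → ℝ) :
    complexify (r • u) (r • v) = (r : ℂ) • complexify u v := by
  simp only [complexify, toC_add, toC_sub, toC_smul]
  module

/-- The affine projection of `ℂ ^ d` onto the hyperplane `⟨z, w⟩ = 1` along the unit vector `w`. -/
def toHyperplane (w : Fin d → ℝ) (z : Fin d → ℂ) : Fin d → ℂ := z + (1 - pair z w) • toC w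

theorem pair_toHyperplane {w : Fin d → ℝ} (hw : w ⬝ᵥ w = 1) (z : Fin d → ℂ) :
    pair (toHyperplane w z) w = 1 := by
  rw [toHyperplane, pair_add, pair_smul, pair_toC, hw]
  push_cast
  ring

theorem toHyperplane_of_pair {w : Fin d → ℝ} {z : Fin d → ℂ} (hz : pair z w = 1) :
    toHyperplane w z = z := by
  rw [toHyperplane, hz, sub_self, zero_smul, add_zero]

theorem differentiable_pair (w : Fin d → ℝ) :
    Differentiable ℂ fun z : Fin d → ℂ => pair z w := by
  unfold pair dotProduct
  fun_prop

theorem differentiable_toHyperplane (w : Fin d → ℝ) : Differentiable ℂ (toHyperplane w) := by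
  have := differentiable_pair w
  unfold toHyperplane
  fun_prop

/-- `U` is relatively open in the hyperplane `⟨z, w⟩ = 1`. -/
theorem isOpen_preimage_domain {w : Fin d → ℝ} (hw : w ⬝ᵥ w = 1) (K : Fin m → Set (Fin d → ℝ)) :
    IsOpen (toHyperplane w ⁻¹' domain K w) := by
  rw [domain, preimage_iUnion]
  refine isOpen_iUnion fun j => ?_
  -- The vectors `(u + v) + i (u - v)` with `u` and `v` in the interior of the cone.
  let O : Set (Fin d → ℂ) := {z | (fun k => ((z k).re + (z k).im) / 2) ∈ interior (K j) ∧
    (fun k => ((z k).re - (z k).im) / 2) ∈ interior (K j)}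
  have hO : IsOpen O := by
    refine (isOpen_interior.preimage ?_).inter (isOpen_interior.preimage ?_)
    · exact continuous_pi fun k => ((Complex.continuous_re.comp (continuous_apply k)).add
        (Complex.continuous_im.comp (continuous_apply k))).div_const 2
    · exact continuous_pi fun k => ((Complex.continuous_re.comp (continuous_apply k)).sub
        (Complex.continuous_im.comp (continuous_apply k))).div_const 2
  have heq : toHyperplane w ⁻¹' coneDomain (K j) w =
      ⋃ (c : ℂ) (_ : c ≠ 0), (fun z => c • toHyperplane w z) ⁻¹' O := by
    ext z
    simp only [mem_preimage, mem_iUnion, exists_prop]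
    constructor
    · rintro ⟨h1, c, u, hu, v, hv, hz⟩
      have hc : c ≠ 0 := by
        rintro rfl
        rw [hz, zero_smul] at h1
        simp [pair] at h1
      refine ⟨c⁻¹, inv_ne_zero hc, ?_⟩
      rw [hz, inv_smul_smul₀ hc]
      constructor
      · convert hu using 1
        ext k
        simp [toC]
      · convert hv using 1
        ext k
        simp [toC]
    · rintro ⟨c, hc, hu, hv⟩
      refine ⟨pair_toHyperplane hw z, c⁻¹, _, hu, _, hv, ?_⟩
      rw [eq_inv_smul_iff₀ hc]
      ext k
      simp only [Pi.add_apply, Pi.smul_apply, toC, Pi.sub_apply, smul_eq_mul]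
      conv_lhs => rw [← Complex.re_add_im (c * toHyperplane w z k)]
      push_cast
      ring
  rw [heq]
  refine isOpen_iUnion fun c => isOpen_iUnion fun _ => hO.preimage ?_
  exact (differentiable_toHyperplane w).continuous.const_smul c

variable {S : Set (Matrix (Fin d) (Fin d) ℝ)} {K : Fin m → Set (Fin d → ℝ)} {w : Fin d → ℝ}

theorem IsMulticone.dotProduct_pos (h : IsMulticone S K w) {j : Fin m} {u : Fin d → ℝ}
    (hu : u ∈ interior (K j)) : 0 < u ⬝ᵥ w := by
  refine h.transverse j u (interior_subset hu) ?_
  rintro rfl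
  -- If `0` were interior, a small negative multiple of `w` would belong to the cone.
  have hc : Tendsto (fun t : ℝ => -t • w) (𝓝[>] 0) (𝓝 0) := by
    have : Continuous fun t : ℝ => -t • w := by fun_prop
    have h2 := this.tendsto 0
    simp only [neg_zero, zero_smul] at h2
    exact h2.mono_left nhdsWithin_le_nhds
  have hev := hc.eventually (isOpen_interior.mem_nhds hu)
  obtain ⟨t, ht, ht0⟩ := (hev.and self_mem_nhdsWithin).exists
  have ht0 : 0 < t := ht0
  have hneg : (-t • w) ⬝ᵥ w = -t := by rw [smul_dotProduct, h.unit, smul_eq_mul, mul_one]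
  have := h.transverse j _ (interior_subset ht) (fun h0 => by
    rw [h0, zero_dotProduct] at hneg
    linarith)
  linarith

theorem IsMulticone.dotProduct_nonneg (h : IsMulticone S K w) {j : Fin m} {u : Fin d → ℝ}
    (hu : u ∈ K j) : 0 ≤ u ⬝ᵥ w := by
  rcases eq_or_ne u 0 with rfl | h0
  · rw [zero_dotProduct]
  · exact (h.transverse j u hu h0).le

/-- The pairs of vectors of a cone, normalized by `⟨u, w⟩ + ⟨v, w⟩ = 1`. -/
def normalizedPairs (K : Set (Fin d → ℝ)) (w : Fin d → ℝ) : Set ((Fin d → ℝ) × (Fin d → ℝ)) :=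
  {q | q.1 ∈ K ∧ q.2 ∈ K ∧ q.1 ⬝ᵥ w + q.2 ⬝ᵥ w = 1}

theorem IsMulticone.isCompact_normalizedPairs (h : IsMulticone S K w) (j : Fin m) :
    IsCompact (normalizedPairs (K j) w) := by
  have hcont : Continuous fun u : Fin d → ℝ => u ⬝ᵥ w := by
    unfold dotProduct
    fun_prop
  obtain ⟨δ, hδ, hle⟩ := ((isCompact_sphere (0 : Fin d → ℝ) 1).inter_left
    (h.isClosed j)).exists_forall_le' hcont.continuousOn (a := 0) fun u hu =>
      h.transverse j u hu.1 (Metric.ne_of_mem_sphere hu.2 one_ne_zero)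
  -- By homogeneity and transversality `‖u‖` is bounded by a multiple of `⟨u, w⟩` on the cone.
  have hbound : ∀ u ∈ K j, ‖u‖ ≤ δ⁻¹ * (u ⬝ᵥ w) := by
    intro u hu
    rcases eq_or_ne u 0 with rfl | h0
    · simp
    have hn : 0 < ‖u‖ := norm_pos_iff.2 h0
    have := hle (‖u‖⁻¹ • u) ⟨h.smul_mem j _ (inv_nonneg.2 hn.le) u hu, by
      rw [mem_sphere_zero_iff_norm, norm_smul, norm_inv, norm_norm, inv_mul_cancel₀ hn.ne']⟩
    rw [smul_dotProduct, smul_eq_mul, le_inv_mul_iff₀ hn] at this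
    rw [le_inv_mul_iff₀ hδ]
    linarith
  refine Metric.isCompact_of_isClosed_isBounded ?_ ?_
  · refine ((h.isClosed j).preimage continuous_fst).inter
      (((h.isClosed j).preimage continuous_snd).inter ?_)
    exact isClosed_eq ((hcont.comp continuous_fst).add (hcont.comp continuous_snd))
      continuous_const
  · refine (Metric.isBounded_closedBall (x := 0) (r := δ⁻¹)).subset ?_
    rintro ⟨u, v⟩ ⟨hu, hv, huv⟩
    have h1 := h.dotProduct_nonneg hu
    have h2 := h.dotProduct_nonneg hv
    have hδ' := inv_pos.2 hδ
    simp only at hu hv huv h1 h2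
    rw [mem_closedBall_zero_iff, Prod.norm_def]
    refine max_le ((hbound u hu).trans ?_) ((hbound v hv).trans ?_)
    · nlinarith
    · nlinarith

/-- The point of the hyperplane `⟨z, w⟩ = 1` defined by a normalized pair. -/
noncomputable def pairPoint (w : Fin d → ℝ) (q : (Fin d → ℝ) × (Fin d → ℝ)) : Fin d → ℂ :=
  (1 + Complex.I * ((q.1 ⬝ᵥ w - q.2 ⬝ᵥ w : ℝ) : ℂ))⁻¹ • complexify q.1 q.2

theorem one_add_I_mul_ne_zero (r : ℝ) : 1 + Complex.I * (r : ℂ) ≠ 0 := by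
  intro h
  have := congrArg Complex.re h
  simp at this

theorem continuous_pairPoint (w : Fin d → ℝ) : Continuous (pairPoint w) := by
  have h1 : Continuous fun q : (Fin d → ℝ) × (Fin d → ℝ) => (q.1 ⬝ᵥ w - q.2 ⬝ᵥ w : ℝ) := by
    unfold dotProduct
    fun_prop
  have h2 : Continuous fun q : (Fin d → ℝ) × (Fin d → ℝ) => complexify q.1 q.2 := by
    refine continuous_pi fun k => ?_
    simp only [complexify, toC, Pi.add_apply, Pi.smul_apply, Pi.sub_apply]
    fun_prop
  exact ((continuous_const.add (continuous_const.mul (Complex.continuous_ofReal.comp h1))).inv₀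
    fun q => one_add_I_mul_ne_zero _).smul h2

theorem IsMulticone.coneDomain_subset (h : IsMulticone S K w) (j : Fin m) :
    coneDomain (K j) w ⊆ pairPoint w '' normalizedPairs (K j) w := by
  rintro z ⟨h1, c, u, hu, v, hv, rfl⟩
  have ha := h.dotProduct_pos hu
  have hb := h.dotProduct_pos hv
  set s := u ⬝ᵥ w + v ⬝ᵥ w with hs
  have hs0 : 0 < s := by positivity
  have hsC : (s : ℂ) ≠ 0 := Complex.ofReal_ne_zero.2 hs0.ne'
  refine ⟨(s⁻¹ • u, s⁻¹ • v), ⟨h.smul_mem j _ (by positivity) _ (interior_subset hu),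
    h.smul_mem j _ (by positivity) _ (interior_subset hv), ?_⟩, ?_⟩
  · simp only [smul_dotProduct, smul_eq_mul]
    rw [← mul_add, ← hs, inv_mul_cancel₀ hs0.ne']
  · change pair (c • complexify u v) w = 1 at h1
    rw [pair_smul, pair_complexify, ← hs] at h1
    change _ = c • complexify u v
    have hc := eq_inv_of_mul_eq_one_left h1
    rw [pairPoint, complexify_smul, smul_smul, hc]
    congr 1
    simp only [smul_dotProduct, smul_eq_mul, ← mul_sub]
    rw [Complex.ofReal_mul, Complex.ofReal_inv, ← mul_inv]
    congr 1
    field_simp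

/-- A matrix of the multicone maps two nonzero vectors of a cone into the same one of the sets
`int K_l` and `-int K_l`, as the segment between them does not pass through `0`. -/
theorem IsMulticone.same_sign (h : IsMulticone S K w) {A : Matrix (Fin d) (Fin d) ℝ} {j l : Fin m}
    (hl : ∀ u ∈ K j, u ≠ 0 → A *ᵥ u ∈ interior (K l) ∨ -(A *ᵥ u) ∈ interior (K l))
    {u v : Fin d → ℝ} (hu : u ∈ K j) (hv : v ∈ K j) (hu0 : u ≠ 0)
    (hv0 : v ≠ 0) (hAu : A *ᵥ u ∈ interior (K l)) : A *ᵥ v ∈ interior (K l) := by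
  refine (hl v hv hv0).resolve_right fun hneg => ?_
  have ha := h.dotProduct_pos hAu
  have hb := h.dotProduct_pos hneg
  set a := (A *ᵥ u) ⬝ᵥ w with ha'
  set b := -(A *ᵥ v) ⬝ᵥ w with hb'
  have hb'' : (A *ᵥ v) ⬝ᵥ w = -b := by rw [hb', neg_dotProduct, neg_neg]
  -- The point of the segment from `u` to `v` at which `⟨A ·, w⟩` vanishes.
  set q := (b / (a + b)) • u + (a / (a + b)) • v with hq
  have hqK : q ∈ K j := h.convex j hu hv (by positivity) (by positivity) (by field_simp; ring)
  have hq0 : q ≠ 0 := by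
    intro h0
    have h1 : q ⬝ᵥ w = (b / (a + b)) * (u ⬝ᵥ w) + (a / (a + b)) * (v ⬝ᵥ w) := by
      rw [hq, add_dotProduct, smul_dotProduct, smul_dotProduct, smul_eq_mul, smul_eq_mul]
    have h2 := h.transverse j u hu hu0
    have h3 := h.transverse j v hv hv0
    rw [h0, zero_dotProduct] at h1
    have : 0 < (b / (a + b)) * (u ⬝ᵥ w) + (a / (a + b)) * (v ⬝ᵥ w) := by positivity
    linarith
  have hz : (A *ᵥ q) ⬝ᵥ w = 0 := by
    rw [hq, mulVec_add, mulVec_smul, mulVec_smul, add_dotProduct, smul_dotProduct, smul_dotProduct,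
      hb'', ← ha', smul_eq_mul, smul_eq_mul]
    field_simp
    ring
  rcases hl q hqK hq0 with h1 | h1
  · exact (h.dotProduct_pos h1).ne' hz
  · exact (h.dotProduct_pos h1).ne' (by rw [neg_dotProduct, hz, neg_zero])

/-- The projective action maps all points of normalized pairs, including those on the boundary of
the cone, into `U`. -/
theorem IsMulticone.proj_pairPoint (h : IsMulticone S K w) {A : Matrix (Fin d) (Fin d) ℝ}
    (hA : A ∈ S) {j : Fin m} {q : (Fin d → ℝ) × (Fin d → ℝ)} (hq : q ∈ normalizedPairs (K j) w) :
    (pair (act A (pairPoint w q)) w).re ≠ 0 ∧ proj w A (pairPoint w q) ∈ domain K w := by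
  obtain ⟨u, v⟩ := q
  obtain ⟨hu, hv, huv⟩ := hq
  simp only at hu hv huv
  obtain ⟨l, hl⟩ := h.maps A hA j
  set a := u ⬝ᵥ w with ha
  set b := v ⬝ᵥ w with hb
  have ha0 : 0 ≤ a := h.dotProduct_nonneg hu
  have hb0 : 0 ≤ b := h.dotProduct_nonneg hv
  have hne : u ≠ 0 ∨ v ≠ 0 := by
    by_contra! h0
    rw [ha, hb, h0.1, h0.2, zero_dotProduct, zero_add] at huv
    exact zero_ne_one huv
  set c : ℂ := (1 + Complex.I * ((a - b : ℝ) : ℂ))⁻¹ with hc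
  have hact : act A (pairPoint w (u, v)) = c • complexify (A *ᵥ u) (A *ᵥ v) := by
    rw [pairPoint, act_smul, act_complexify]
  set a' := (A *ᵥ u) ⬝ᵥ w with ha'
  set b' := (A *ᵥ v) ⬝ᵥ w with hb'
  have hre : (pair (act A (pairPoint w (u, v))) w).re =
      2 * (a * a' + b * b') / (1 + (a - b) ^ 2) := by
    rw [hact, pair_smul, pair_complexify, ← ha', ← hb', hc]
    have hb1 : b = 1 - a := by linarith
    have hns : Complex.normSq (1 + Complex.I * ((a - b : ℝ) : ℂ)) = 1 + (a - b) ^ 2 := by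
      rw [Complex.normSq_apply]
      simp
      ring
    rw [Complex.mul_re, Complex.inv_re, Complex.inv_im, hns]
    simp
    rw [hb1]
    field_simp
    ring
  -- If one of the vectors is zero, the image is a multiple of the image of the other one.
  have hrep : (a * a' + b * b' ≠ 0) ∧ ∃ c' : ℂ, ∃ x ∈ interior (K l), ∃ y ∈ interior (K l),
      complexify (A *ᵥ u) (A *ᵥ v) = c' • complexify x y := by
    have hdup : ∀ y : Fin d → ℝ, complexify y y = (2 : ℂ) • toC y := by
      intro y
      rw [complexify, toC_add, toC_sub]
      module
    have hzero : A *ᵥ (0 : Fin d → ℝ) = 0 := mulVec_zero A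
    have hsgn : ∀ y : Fin d → ℝ, (y ∈ interior (K l) ∨ -y ∈ interior (K l)) →
        y ⬝ᵥ w ≠ 0 ∧ ∃ c' : ℂ, ∃ x ∈ interior (K l), toC y = c' • toC x := by
      rintro y (hy | hy)
      · exact ⟨(h.dotProduct_pos hy).ne', 1, y, hy, (one_smul _ _).symm⟩
      · refine ⟨fun h0 => (h.dotProduct_pos hy).ne' (by rw [neg_dotProduct, h0, neg_zero]),
          -1, -y, hy, ?_⟩
        ext k
        simp [toC]
    by_cases hu0 : u = 0
    · have hv0 : v ≠ 0 := hne.resolve_left (fun h => h hu0)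
      obtain ⟨hn, c', x, hx, he⟩ := hsgn _ (hl v hv hv0)
      have hbpos := h.transverse j v hv hv0
      refine ⟨?_, (1 - Complex.I) / 2 * c', x, hx, x, hx, ?_⟩
      · rw [ha, hu0, zero_dotProduct, zero_mul, zero_add]
        exact mul_ne_zero hbpos.ne' hn
      · rw [hu0, hzero, hdup, complexify, zero_add, zero_sub, he]
        have : toC (-(A *ᵥ v)) = -toC (A *ᵥ v) := by ext k; simp [toC]
        rw [this, he]
        module
    by_cases hv0 : v = 0
    · obtain ⟨hn, c', x, hx, he⟩ := hsgn _ (hl u hu hu0)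
      have hapos := h.transverse j u hu hu0
      refine ⟨?_, (1 + Complex.I) / 2 * c', x, hx, x, hx, ?_⟩
      · rw [hb, hv0, zero_dotProduct, zero_mul, add_zero]
        exact mul_ne_zero hapos.ne' hn
      · rw [hv0, hzero, hdup, complexify, add_zero, sub_zero, he]
        module
    have hapos : 0 < a := h.transverse j u hu hu0
    have hbpos : 0 < b := h.transverse j v hv hv0
    rcases hl u hu hu0 with hAu | hAu
    · have hAv := h.same_sign hl hu hv hu0 hv0 hAu
      have h1 := h.dotProduct_pos hAu
      have h2 := h.dotProduct_pos hAv
      exact ⟨by positivity, 1, _, hAu, _, hAv, (one_smul _ _).symm⟩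
    · have hAv : -(A *ᵥ v) ∈ interior (K l) := by
        refine (hl v hv hv0).resolve_left fun hAv => ?_
        have h1 := h.dotProduct_pos (h.same_sign hl hv hu hv0 hu0 hAv)
        have h2 := h.dotProduct_pos hAu
        rw [neg_dotProduct] at h2
        linarith
      have h1 := h.dotProduct_pos hAu
      have h2 := h.dotProduct_pos hAv
      rw [neg_dotProduct] at h1 h2
      refine ⟨ne_of_lt (by nlinarith), -1, _, hAu, _, hAv, ?_⟩
      have := complexify_smul (-1) (A *ᵥ u) (A *ᵥ v)
      rw [neg_one_smul, neg_one_smul] at this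
      rw [this]
      simp
  obtain ⟨hne0, c', x, hx, y, hy, hxy⟩ := hrep
  have hre0 : (pair (act A (pairPoint w (u, v))) w).re ≠ 0 := by
    rw [hre]
    exact div_ne_zero (mul_ne_zero two_ne_zero hne0) (by positivity)
  refine ⟨hre0, mem_iUnion.2 ⟨l, pair_proj (fun h0 => hre0 (by rw [h0, Complex.zero_re])), ?_⟩⟩
  refine ⟨(pair (act A (pairPoint w (u, v))) w)⁻¹ * c * c', x, hx, y, hy, ?_⟩
  rw [proj]
  nth_rewrite 2 [hact]
  rw [hxy, smul_smul, smul_smul]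
  rfl

/-- `U` is contained in a compact set which the projective action of the multicone maps into `U`. -/
theorem IsMulticone.exists_compact_hull (h : IsMulticone S K w) :
    ∃ W : Set (Fin d → ℂ), IsCompact W ∧ domain K w ⊆ W ∧ ∀ A ∈ S, ∀ z ∈ W,
      (pair (act A z) w).re ≠ 0 ∧ proj w A z ∈ domain K w := by
  refine ⟨⋃ j, pairPoint w '' normalizedPairs (K j) w,
    isCompact_iUnion fun j => (h.isCompact_normalizedPairs j).image (continuous_pairPoint w),
    iUnion_mono fun j => h.coneDomain_subset j, fun A hA z hz => ?_⟩
  obtain ⟨j, q, hq, rfl⟩ := mem_iUnion.1 hz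
  exact h.proj_pairPoint hA hq

end FastLyapunov

/-! ### Elements of the space `𝓑(U, κ)` -/

namespace FastLyapunov

variable {N d : ℕ} {T : Matrix (Fin N) (Fin N) ℕ}

/-- Two points of the shift agree in their first `k` symbols. -/
def SFT.Agree (k : ℕ) (x y : SFT T) : Prop := ∀ i < k, x.1 i = y.1 i

theorem SFT.Agree.cons {k : ℕ} {x y : SFT T} (h : SFT.Agree k x y)
    {i : {i : Fin N // T i (x.1 0) = 1}} {j : {i : Fin N // T i (y.1 0) = 1}} (hij : i.1 = j.1) :
    SFT.Agree (k + 1) (x.cons i) (y.cons j) := by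
  intro n hn
  cases n with
  | zero => exact hij
  | succ n => exact h n (by omega)

theorem SFT.edist_le_var {V : Type*} [PseudoEMetricSpace V] (f : SFT T → V) {k : ℕ} {x y : SFT T}
    (h : SFT.Agree k x y) : edist (f x) (f y) ≤ SFT.var k f :=
  le_iSup_of_le x (le_iSup_of_le y
    (le_iSup (fun _ : ∀ i < k, x.1 i = y.1 i => edist (f x) (f y)) h))

theorem SFT.VarBigO.exists_dist_le {V : Type*} [PseudoMetricSpace V] {f : SFT T → V} {κ : ℕ → ℝ}
    (hκ : ∀ k, 0 < κ k) (h : SFT.VarBigO f κ) :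
    ∃ M : ℝ, 0 ≤ M ∧ ∀ k, 1 ≤ k → ∀ x y, SFT.Agree k x y → dist (f x) (f y) ≤ M * κ k := by
  obtain ⟨M, hM⟩ := h
  refine ⟨M, M.2, fun k hk x y hxy => ?_⟩
  have h1 : edist (f x) (f y) ≤ M * ENNReal.ofReal (κ k) :=
    (SFT.edist_le_var f hxy).trans (hM k hk)
  rw [edist_dist, ← ENNReal.ofReal_coe_nnreal, ← ENNReal.ofReal_mul M.coe_nonneg,
    ENNReal.ofReal_le_ofReal_iff (mul_nonneg M.coe_nonneg (hκ k).le)] at h1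
  exact h1

variable {U : Set (Fin d → ℂ)} {κ : ℕ → ℝ}

theorem bNorm_le_ofReal {F : SFT T → (Fin d → ℂ) → ℂ} {a b : ℝ}
    (ha0 : 0 ≤ a) (hb0 : 0 ≤ b) (ha : ∀ x, ∀ z ∈ U, ‖F x z‖ ≤ a)
    (hb : ∀ k, 1 ≤ k → ∀ x y, SFT.Agree k x y → ∀ z ∈ U, ‖F x z - F y z‖ ≤ b * κ k) :
    bNorm U κ F ≤ ENNReal.ofReal (a + b) := by
  refine iSup₂_le fun z hz => ?_
  rw [ENNReal.ofReal_add ha0 hb0]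
  refine add_le_add (iSup_le fun x => ?_) (iSup₂_le fun k hk => ?_)
  · rw [← ofReal_norm]
    exact ENNReal.ofReal_le_ofReal (ha x z hz)
  · refine ENNReal.div_le_of_le_mul ?_
    rw [← ENNReal.ofReal_mul hb0]
    refine iSup_le fun x => iSup_le fun y => iSup_le fun hxy => ?_
    rw [edist_eq_enorm_sub, ← ofReal_norm]
    exact ENNReal.ofReal_le_ofReal (hb k hk x y hxy z hz)

namespace BSpace

/-- An element of `𝓑(U, κ)` from a function with explicit bounds. Continuity in the first variable
follows from the decay of the variations. -/
def ofBounds (hκ0 : Tendsto κ atTop (𝓝 0)) (F : SFT T → (Fin d → ℂ) → ℂ)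
    (h0 : ∀ x, ∀ z ∉ U, F x z = 0) (hd : ∀ x, DifferentiableOn ℂ (F x) U) (a b : ℝ)
    (ha0 : 0 ≤ a) (hb0 : 0 ≤ b) (ha : ∀ x, ∀ z ∈ U, ‖F x z‖ ≤ a)
    (hb : ∀ k, 1 ≤ k → ∀ x y, SFT.Agree k x y → ∀ z ∈ U, ‖F x z - F y z‖ ≤ b * κ k) :
    BSpace T U κ :=
  ⟨F, h0, hd, fun z hz => SFT.continuous_of_var_tendsto (b := fun k => b * κ k)
      (by simpa using hκ0.const_mul b)
      fun k hk x y hxy => by rw [dist_eq_norm]; exact hb k hk x y hxy z hz,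
    (bNorm_le_ofReal ha0 hb0 ha hb).trans_lt ENNReal.ofReal_lt_top⟩

theorem toFun_add (f g : BSpace T U κ) : (f + g).toFun = f.toFun + g.toFun := rfl

theorem toFun_smul (c : ℂ) (f : BSpace T U κ) : (c • f).toFun = c • f.toFun := rfl

theorem toFun_sum {ι : Type*} (s : Finset ι) (f : ι → BSpace T U κ) :
    (∑ i ∈ s, f i).toFun = ∑ i ∈ s, (f i).toFun :=
  map_sum (bSubmodule T U κ).subtype f s

theorem toFun_injective : Function.Injective (toFun : BSpace T U κ → _) := Subtype.val_injective

theorem toFun_of_notMem (f : BSpace T U κ) (x : SFT T) {z : Fin d → ℂ} (hz : z ∉ U) :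
    f.toFun x z = 0 :=
  f.2.1 x z hz

theorem differentiableOn (f : BSpace T U κ) (x : SFT T) : DifferentiableOn ℂ (f.toFun x) U :=
  f.2.2.1 x

theorem norm_le_of_bounds (f : BSpace T U κ) {a b : ℝ}
    (ha0 : 0 ≤ a) (hb0 : 0 ≤ b) (ha : ∀ x, ∀ z ∈ U, ‖f.toFun x z‖ ≤ a)
    (hb : ∀ k, 1 ≤ k → ∀ x y, SFT.Agree k x y → ∀ z ∈ U,
      ‖f.toFun x z - f.toFun y z‖ ≤ b * κ k) :
    ‖f‖ ≤ a + b := by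
  rw [norm_def]
  exact ENNReal.toReal_le_of_le_ofReal (add_nonneg ha0 hb0) (bNorm_le_ofReal ha0 hb0 ha hb)

theorem enorm_apply_le (f : BSpace T U κ) (x : SFT T) {z : Fin d → ℂ} (hz : z ∈ U) :
    ‖f.toFun x z‖ₑ ≤ bNorm U κ f.toFun := by
  refine le_trans ?_ (le_iSup₂ (f := fun z (_ : z ∈ U) => ((⨆ x, ‖f.toFun x z‖ₑ) +
    ⨆ (k : ℕ) (_ : 1 ≤ k), SFT.var k (fun x => f.toFun x z) / ENNReal.ofReal (κ k))) z hz)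
  exact (le_iSup (fun x => ‖f.toFun x z‖ₑ) x).trans le_self_add

theorem norm_apply_le (f : BSpace T U κ) (x : SFT T) {z : Fin d → ℂ} (hz : z ∈ U) :
    ‖f.toFun x z‖ ≤ ‖f‖ := by
  rw [norm_def, ← toReal_enorm]
  exact ENNReal.toReal_mono f.2.2.2.2.ne (f.enorm_apply_le x hz)

theorem norm_apply_sub_le (hκ : ∀ k, 0 < κ k) (f : BSpace T U κ) {k : ℕ} (hk : 1 ≤ k)
    {x y : SFT T} (hxy : SFT.Agree k x y) {z : Fin d → ℂ} (hz : z ∈ U) :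
    ‖f.toFun x z - f.toFun y z‖ ≤ κ k * ‖f‖ := by
  have h1 : SFT.var k (fun x => f.toFun x z) / ENNReal.ofReal (κ k) ≤ bNorm U κ f.toFun := by
    refine le_trans ?_ (le_iSup₂ (f := fun z (_ : z ∈ U) => ((⨆ x, ‖f.toFun x z‖ₑ) +
      ⨆ (k : ℕ) (_ : 1 ≤ k), SFT.var k (fun x => f.toFun x z) / ENNReal.ofReal (κ k))) z hz)
    exact (le_iSup₂ (f := fun (k : ℕ) (_ : 1 ≤ k) =>
      SFT.var k (fun x => f.toFun x z) / ENNReal.ofReal (κ k)) k hk).trans le_add_self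
  have hpos : ENNReal.ofReal (κ k) ≠ 0 := (ENNReal.ofReal_pos.2 (hκ k)).ne'
  have h2 := (ENNReal.div_le_iff hpos ENNReal.ofReal_ne_top).1 h1
  have h3 : edist (f.toFun x z) (f.toFun y z) ≤ bNorm U κ f.toFun * ENNReal.ofReal (κ k) :=
    (SFT.edist_le_var (fun x => f.toFun x z) hxy).trans h2
  rw [edist_eq_enorm_sub] at h3
  have h4 := ENNReal.toReal_mono
    (ENNReal.mul_ne_top f.2.2.2.2.ne ENNReal.ofReal_ne_top) h3
  rwa [toReal_enorm, ENNReal.toReal_mul, ENNReal.toReal_ofReal (hκ k).le, mul_comm] at h4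

/-- The operator `f ↦ ((y, z) ↦ f(x, z))`. -/
noncomputable def freeze (hκ0 : Tendsto κ atTop (𝓝 0)) (x : SFT T) :
    BSpace T U κ →L[ℂ] BSpace T U κ :=
  LinearMap.mkContinuous
    { toFun := fun f => ofBounds hκ0 (fun _ z => f.toFun x z) (fun _ _ hz => f.toFun_of_notMem x hz)
        (fun _ => f.differentiableOn x) ‖f‖ 0 (norm_nonneg f) le_rfl
        (fun _ _ hz => f.norm_apply_le x hz) (fun _ _ _ _ _ _ _ => by simp)
      map_add' := fun _ _ => rfl
      map_smul' := fun _ _ => rfl } 1 fun f => by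
    rw [one_mul, ← add_zero ‖f‖]
    exact norm_le_of_bounds _ (norm_nonneg f) le_rfl (fun _ _ hz => f.norm_apply_le x hz)
      (fun _ _ _ _ _ _ _ => by rw [zero_mul]; exact (norm_eq_zero.2 (sub_self _)).le)

theorem norm_freeze_le (hκ0 : Tendsto κ atTop (𝓝 0)) (x : SFT T)
    (f : BSpace T U κ) : ‖freeze hκ0 x f‖ ≤ ‖f‖ := by
  have := norm_le_of_bounds (freeze hκ0 x f) (norm_nonneg f) le_rfl
    (fun _ _ hz => f.norm_apply_le x hz)
    (fun _ _ _ _ _ _ _ => by rw [zero_mul]; exact (norm_eq_zero.2 (sub_self _)).le)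
  rwa [add_zero] at this

theorem norm_freeze_sub_le (hκ : ∀ k, 0 < κ k) (hκ0 : Tendsto κ atTop (𝓝 0)) {k : ℕ} (hk : 1 ≤ k)
    {x y : SFT T} (hxy : SFT.Agree k x y) (f : BSpace T U κ) :
    ‖freeze hκ0 x f - freeze hκ0 y f‖ ≤ κ k * ‖f‖ := by
  have := norm_le_of_bounds (freeze hκ0 x f - freeze hκ0 y f)
    (mul_nonneg (hκ k).le (norm_nonneg f)) le_rfl
    (fun _ _ hz => f.norm_apply_sub_le hκ hk hxy hz)
    (fun _ _ _ _ _ _ _ => by rw [zero_mul]; exact (norm_eq_zero.2 (sub_self _)).le)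
  rwa [add_zero] at this

end BSpace

/-! ### Kernels with rapidly decaying variations -/

/-- Bounded functions on `Σ_T⁺ × U` with values in a normed space, whose variations in the first
variable are `O(κ_k)`, uniformly on `U`. -/
def IsKernel {E : Type*} [NormedAddCommGroup E] (U : Set (Fin d → ℂ)) (κ : ℕ → ℝ)
    (G : SFT T → (Fin d → ℂ) → E) : Prop :=
  ∃ C : ℝ, 0 ≤ C ∧ (∀ y, ∀ z ∈ U, ‖G y z‖ ≤ C) ∧
    ∀ k, 1 ≤ k → ∀ y y', SFT.Agree k y y' → ∀ z ∈ U, ‖G y z - G y' z‖ ≤ C * κ k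

namespace IsKernel

variable {E E' : Type*} [NormedAddCommGroup E] [NormedAddCommGroup E']

theorem of_bounded (hκ : ∀ k, 0 < κ k) {g : (Fin d → ℂ) → E} {C : ℝ}
    (h : ∀ z ∈ U, ‖g z‖ ≤ C) : IsKernel U κ (fun (_ : SFT T) z => g z) := by
  refine ⟨max C 0, le_max_right _ _, fun _ z hz => (h z hz).trans (le_max_left _ _), ?_⟩
  intro k _ _ _ _ z _
  rw [sub_self, norm_zero]
  exact mul_nonneg (le_max_right _ _) (hκ k).le

theorem add {G H : SFT T → (Fin d → ℂ) → E} (hG : IsKernel U κ G)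
    (hH : IsKernel U κ H) : IsKernel U κ (fun y z => G y z + H y z) := by
  obtain ⟨C, hC0, hC1, hC2⟩ := hG
  obtain ⟨D, hD0, hD1, hD2⟩ := hH
  refine ⟨C + D, add_nonneg hC0 hD0, fun y z hz =>
    norm_add_le_of_le (hC1 y z hz) (hD1 y z hz), fun k hk y y' hy z hz => ?_⟩
  rw [add_sub_add_comm, add_mul]
  exact norm_add_le_of_le (hC2 k hk y y' hy z hz) (hD2 k hk y y' hy z hz)

theorem mul (hκ : ∀ k, 0 < κ k) {G H : SFT T → (Fin d → ℂ) → ℂ} (hG : IsKernel U κ G)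
    (hH : IsKernel U κ H) : IsKernel U κ (fun y z => G y z * H y z) := by
  obtain ⟨C, hC0, hC1, hC2⟩ := hG
  obtain ⟨D, hD0, hD1, hD2⟩ := hH
  refine ⟨2 * (C * D), by positivity, fun y z hz => ?_, fun k hk y y' hy z hz => ?_⟩
  · rw [norm_mul]
    have := mul_le_mul (hC1 y z hz) (hD1 y z hz) (norm_nonneg _) hC0
    nlinarith [mul_nonneg hC0 hD0]
  · have e : G y z * H y z - G y' z * H y' z =
        (G y z - G y' z) * H y z + G y' z * (H y z - H y' z) := by ring
    rw [e]
    refine (norm_add_le _ _).trans ?_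
    rw [norm_mul, norm_mul]
    have h1 := mul_le_mul (hC2 k hk y y' hy z hz) (hD1 y z hz) (norm_nonneg _)
      (mul_nonneg hC0 (hκ k).le)
    have h2 := mul_le_mul (hC1 y' z hz) (hD2 k hk y y' hy z hz) (norm_nonneg _) hC0
    linarith

theorem sum (hκ : ∀ k, 0 < κ k) {ι : Type*} (s : Finset ι) {G : ι → SFT T → (Fin d → ℂ) → E}
    (hG : ∀ i ∈ s, IsKernel U κ (G i)) : IsKernel U κ (fun y z => ∑ i ∈ s, G i y z) := by
  classical
  induction s using Finset.induction_on with
  | empty =>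
    simp only [Finset.sum_empty]
    exact of_bounded hκ (C := 0) fun _ _ => norm_zero.le
  | insert i s hi ih =>
    simp only [Finset.sum_insert hi]
    exact add (hG i (Finset.mem_insert_self _ _))
      (ih fun j hj => hG j (Finset.mem_insert_of_mem hj))

theorem pi (hκ : ∀ k, 0 < κ k) {ι : Type*} [Fintype ι] {G : SFT T → (Fin d → ℂ) → ι → ℂ}
    (hG : ∀ i, IsKernel U κ (fun y z => G y z i)) : IsKernel U κ G := by
  choose C hC0 hC1 hC2 using hG
  have hle : ∀ i, C i ≤ ∑ i, C i := fun i =>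
    Finset.single_le_sum (fun j _ => hC0 j) (Finset.mem_univ i)
  have hs : 0 ≤ ∑ i, C i := Finset.sum_nonneg fun i _ => hC0 i
  refine ⟨∑ i, C i, hs, fun y z hz => (pi_norm_le_iff_of_nonneg hs).2 fun i =>
    (hC1 i y z hz).trans (hle i), fun k hk y y' hy z hz =>
    (pi_norm_le_iff_of_nonneg (mul_nonneg hs (hκ k).le)).2 fun i =>
    (hC2 i k hk y y' hy z hz).trans ?_⟩
  exact mul_le_mul_of_nonneg_right (hle i) (hκ k).le

/-- Composition with a Lipschitz function on a bounded set of values. -/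
theorem comp (hκ : ∀ k, 0 < κ k) {G : SFT T → (Fin d → ℂ) → E} (hG : IsKernel U κ G) {Q : Set E}
    (hQ : ∀ y, ∀ z ∈ U, G y z ∈ Q) {h : E → E'} {C : ℝ} (hC : ∀ e ∈ Q, ‖h e‖ ≤ C)
    (hl : ∀ e ∈ Q, ∀ e' ∈ Q, ‖h e - h e'‖ ≤ C * ‖e - e'‖) :
    IsKernel U κ (fun y z => h (G y z)) := by
  obtain ⟨D, hD0, hD1, hD2⟩ := hG
  refine ⟨max C 0 * (1 + D), by positivity, fun y z hz => ?_, fun k hk y y' hy z hz => ?_⟩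
  · have := hC _ (hQ y z hz)
    nlinarith [le_max_left C 0, le_max_right C 0, mul_nonneg (le_max_right C 0) hD0]
  · have h1 := hl _ (hQ y z hz) _ (hQ y' z hz)
    have h2 := hD2 k hk y y' hy z hz
    have h3 : C * ‖G y z - G y' z‖ ≤ max C 0 * (D * κ k) :=
      mul_le_mul (le_max_left _ _) h2 (norm_nonneg _) (le_max_right _ _)
    have h4 : 0 ≤ max C 0 * κ k := mul_nonneg (le_max_right _ _) (hκ k).le
    linarith

/-- Composition with a locally Lipschitz function on a compact set of values. -/
theorem comp_of_isCompact (hκ : ∀ k, 0 < κ k) {G : SFT T → (Fin d → ℂ) → E} (hG : IsKernel U κ G)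
    {Q : Set E} (hQc : IsCompact Q) (hQ : ∀ y, ∀ z ∈ U, G y z ∈ Q) {h : E → E'}
    (hl : LocallyLipschitzOn Q h) : IsKernel U κ (fun y z => h (G y z)) := by
  obtain ⟨L, hL⟩ := hl.exists_lipschitzOnWith_of_compact hQc
  obtain ⟨C, hC⟩ := hQc.exists_bound_of_continuousOn hL.continuousOn
  refine hG.comp hκ hQ (C := max C L) (fun e he => (hC e he).trans (le_max_left _ _))
    fun e he e' he' => ?_
  rw [← dist_eq_norm, ← dist_eq_norm]
  exact (hL.dist_le_mul e he e' he').trans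
    (mul_le_mul_of_nonneg_right (le_max_right _ _) dist_nonneg)

end IsKernel

end FastLyapunov

namespace FastLyapunov

variable {N d : ℕ} {T : Matrix (Fin N) (Fin N) ℕ} {U : Set (Fin d → ℂ)} {κ : ℕ → ℝ}
  {w : Fin d → ℝ}

/-! ### Transfer operators with general kernels -/

/-- A Lipschitz bound from the Schwarz lemma: the difference of values at two points of `S` is
controlled by the supremum over a neighbourhood of `S`, without convexity of `S`. -/
theorem norm_sub_le_of_cthickening {E : Type*} [NormedAddCommGroup E] [NormedSpace ℂ E]
    {F : E → ℂ} {S : Set E} {r a : ℝ} (hr : 0 < r)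
    (hF : DifferentiableOn ℂ F (Metric.cthickening r S))
    (ha : ∀ z ∈ Metric.cthickening r S, ‖F z‖ ≤ a) {ζ ζ' : E} (hζ : ζ ∈ S) (hζ' : ζ' ∈ S) :
    ‖F ζ - F ζ'‖ ≤ 2 * a / r * ‖ζ - ζ'‖ := by
  have hball : Metric.ball ζ' r ⊆ Metric.cthickening r S :=
    Metric.ball_subset_closedBall.trans (Metric.closedBall_subset_cthickening hζ' r)
  have hsub : ∀ z ∈ Metric.cthickening r S, ‖F z - F ζ'‖ ≤ 2 * a := by
    intro z hz
    have h1 := ha z hz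
    have h2 := ha ζ' (hball (Metric.mem_ball_self hr))
    linarith [norm_sub_le (F z) (F ζ')]
  rcases lt_or_ge ‖ζ - ζ'‖ r with h | h
  · rw [← dist_eq_norm] at h ⊢
    rw [← dist_eq_norm]
    exact Complex.dist_le_div_mul_dist_of_mapsTo_ball (hF.mono hball)
      (fun z hz => mem_closedBall_iff_norm.2 (hsub z (hball hz))) h
  · refine (hsub ζ (Metric.self_subset_cthickening S hζ)).trans ?_
    have ha0 : 0 ≤ a := (norm_nonneg _).trans (ha ζ (Metric.self_subset_cthickening S hζ))
    rw [div_mul_eq_mul_div, le_div_iff₀ hr]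
    exact mul_le_mul_of_nonneg_left h (by positivity)

theorem differentiableOn_comp_toHyperplane {h : (Fin d → ℂ) → ℂ} (hh : DifferentiableOn ℂ h U) :
    DifferentiableOn ℂ (fun z => h (toHyperplane w z)) (toHyperplane w ⁻¹' U) :=
  hh.comp (differentiable_toHyperplane w).differentiableOn fun _ hz => hz

/-- The sum over preimages under the shift, with a weight `G` and an action `τ` on the second
variable. -/
def sumPreimages (G : SFT T → (Fin d → ℂ) → ℂ) (τ : SFT T → (Fin d → ℂ) → Fin d → ℂ)
    (f : SFT T → (Fin d → ℂ) → ℂ) (x : SFT T) (z : Fin d → ℂ) : ℂ :=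
  ∑ i : {i : Fin N // T i (x.1 0) = 1}, G (x.cons i) z * f (x.cons i) (τ (x.cons i) z)

theorem card_preimages_le (x : SFT T) :
    Fintype.card {i : Fin N // T i (x.1 0) = 1} ≤ N :=
  (Fintype.card_subtype_le _).trans_eq (Fintype.card_fin N)

/-- The basic estimate for transfer operators. If `x` and `x'` agree in `k` symbols, corresponding
preimages agree in `k + 1` symbols, so the variations of `f` enter with the index `k + 1`. Only
the values of `f` on a neighbourhood of `S` matter. -/
theorem sumPreimages_bounds (hκ : ∀ k, 0 < κ k) {G : SFT T → (Fin d → ℂ) → ℂ}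
    {τ : SFT T → (Fin d → ℂ) → Fin d → ℂ} (hG : IsKernel U κ G) (hτ : IsKernel U κ τ)
    {S : Set (Fin d → ℂ)} {r : ℝ} (hr : 0 < r)
    (hS : Metric.cthickening r S ⊆ toHyperplane w ⁻¹' U) (hSw : ∀ z ∈ S, pair z w = 1)
    (hτS : ∀ y, ∀ z ∈ U, τ y z ∈ S) :
    ∃ C : ℝ, 0 ≤ C ∧ ∀ (f : SFT T → (Fin d → ℂ) → ℂ), (∀ y, DifferentiableOn ℂ (f y) U) →
      ∀ (a : ℝ) (b : ℕ → ℝ),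
      (∀ y, ∀ ζ ∈ toHyperplane w '' Metric.cthickening r S, ‖f y ζ‖ ≤ a) →
      (∀ k, 1 ≤ k → ∀ y y', SFT.Agree k y y' → ∀ ζ ∈ toHyperplane w '' Metric.cthickening r S,
        ‖f y ζ - f y' ζ‖ ≤ b k) →
      (∀ x, ∀ z ∈ U, ‖sumPreimages G τ f x z‖ ≤ C * a) ∧
      ∀ k, 1 ≤ k → ∀ x x', SFT.Agree k x x' → ∀ z ∈ U,
        ‖sumPreimages G τ f x z - sumPreimages G τ f x' z‖ ≤ C * (κ (k + 1) * a + b (k + 1)) := by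
  obtain ⟨C₁, hC₁, hG1, hG2⟩ := hG
  obtain ⟨C₂, hC₂, hτ1, hτ2⟩ := hτ
  refine ⟨N * (C₁ + C₁ * (2 / r * C₂)), by positivity, fun f hf a b ha hb => ?_⟩
  have hmem : ∀ y, ∀ z ∈ U, τ y z ∈ toHyperplane w '' Metric.cthickening r S := fun y z hz =>
    ⟨τ y z, Metric.self_subset_cthickening S (hτS y z hz),
      toHyperplane_of_pair (hSw _ (hτS y z hz))⟩
  constructor
  · intro x z hz
    have ha0 : 0 ≤ a := (norm_nonneg _).trans (ha x _ (hmem x z hz))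
    calc ‖sumPreimages G τ f x z‖ ≤ ∑ _i : {i : Fin N // T i (x.1 0) = 1}, C₁ * a := by
          refine norm_sum_le_of_le _ fun i _ => ?_
          rw [norm_mul]
          exact mul_le_mul (hG1 _ z hz) (ha _ _ (hmem _ z hz)) (norm_nonneg _) hC₁
      _ = Fintype.card {i : Fin N // T i (x.1 0) = 1} * (C₁ * a) := by
          rw [Finset.sum_const, Finset.card_univ, nsmul_eq_mul]
      _ ≤ N * (C₁ * a) := by
          gcongr
          exact card_preimages_le x
      _ ≤ N * (C₁ + C₁ * (2 / r * C₂)) * a := by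
          rw [mul_assoc, add_mul]
          gcongr
          have : 0 ≤ C₁ * (2 / r * C₂) * a := by positivity
          linarith
  · intro k hk x x' hxx z hz
    have h0 : x.1 0 = x'.1 0 := hxx 0 hk
    have ha0 : 0 ≤ a := (norm_nonneg _).trans (ha x _ (hmem x z hz))
    have hb0 : 0 ≤ b (k + 1) := (norm_nonneg _).trans
      (hb (k + 1) (by omega) x x (fun _ _ => rfl) _ (hmem x z hz))
    have hκ1 := (hκ (k + 1)).le
    let e : {i : Fin N // T i (x.1 0) = 1} ≃ {i : Fin N // T i (x'.1 0) = 1} :=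
      Equiv.subtypeEquivRight fun i => by rw [h0]
    have hterm : ∀ i, ‖G (x.cons i) z * f (x.cons i) (τ (x.cons i) z) -
        G (x'.cons (e i)) z * f (x'.cons (e i)) (τ (x'.cons (e i)) z)‖ ≤
        (C₁ + C₁ * (2 / r * C₂)) * (κ (k + 1) * a + b (k + 1)) := by
      intro i
      have hag : SFT.Agree (k + 1) (x.cons i) (x'.cons (e i)) := hxx.cons rfl
      set y := x.cons i
      set y' := x'.cons (e i)
      have h1 := hG2 (k + 1) (by omega) y y' hag z hz
      have h2 := hb (k + 1) (by omega) y y' hag _ (hmem y z hz)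
      have h3 : ‖f y' (τ y z) - f y' (τ y' z)‖ ≤ 2 * a / r * (C₂ * κ (k + 1)) := by
        have h4 := norm_sub_le_of_cthickening hr
          ((differentiableOn_comp_toHyperplane (w := w) (hf y')).mono hS)
          (fun ζ hζ => ha y' _ ⟨ζ, hζ, rfl⟩) (hτS y z hz) (hτS y' z hz)
        rw [toHyperplane_of_pair (hSw _ (hτS y z hz)),
          toHyperplane_of_pair (hSw _ (hτS y' z hz))] at h4
        refine h4.trans ?_
        gcongr
        exact hτ2 (k + 1) (by omega) y y' hag z hz
      have e1 : G y z * f y (τ y z) - G y' z * f y' (τ y' z) =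
          (G y z - G y' z) * f y (τ y z) + G y' z * (f y (τ y z) - f y' (τ y z)) +
            G y' z * (f y' (τ y z) - f y' (τ y' z)) := by ring
      rw [e1]
      refine (norm_add₃_le).trans ?_
      rw [norm_mul, norm_mul, norm_mul]
      have g1 := mul_le_mul h1 (ha y _ (hmem y z hz)) (norm_nonneg _) (by positivity)
      have g2 := mul_le_mul (hG1 y' z hz) h2 (norm_nonneg _) hC₁
      have g3 := mul_le_mul (hG1 y' z hz) h3 (norm_nonneg _) hC₁
      have g4 : 0 ≤ C₁ * (2 / r * C₂) * b (k + 1) := by positivity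
      have g5 : C₁ * (2 * a / r * (C₂ * κ (k + 1))) = C₁ * (2 / r * C₂) * (κ (k + 1) * a) := by
        ring
      rw [g5] at g3
      linarith
    have hsum : sumPreimages G τ f x' z =
        ∑ i, G (x'.cons (e i)) z * f (x'.cons (e i)) (τ (x'.cons (e i)) z) :=
      (Equiv.sum_comp e fun i => G (x'.cons i) z * f (x'.cons i) (τ (x'.cons i) z)).symm
    rw [hsum, sumPreimages, ← Finset.sum_sub_distrib]
    refine (norm_sum_le_of_le _ fun i _ => hterm i).trans ?_
    rw [Finset.sum_const, Finset.card_univ, nsmul_eq_mul, mul_assoc (N : ℝ)]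
    gcongr
    exact card_preimages_le x

theorem differentiableOn_sumPreimages {G : SFT T → (Fin d → ℂ) → ℂ}
    {τ : SFT T → (Fin d → ℂ) → Fin d → ℂ} (hG : ∀ y, DifferentiableOn ℂ (G y) U)
    (hτ : ∀ y, DifferentiableOn ℂ (τ y) U) (hτU : ∀ y, MapsTo (τ y) U U)
    {f : SFT T → (Fin d → ℂ) → ℂ} (hf : ∀ y, DifferentiableOn ℂ (f y) U) (x : SFT T) :
    DifferentiableOn ℂ (sumPreimages G τ f x) U := by
  unfold sumPreimages
  refine DifferentiableOn.fun_sum fun i _ => (hG _).mul ?_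
  exact (hf _).comp (hτ _) (hτU _)

/-! ### Grids on which a holomorphic function is controlled -/

/-- On a compact part of `U`, holomorphic functions that vanish on a suitable set of `O(M ^ d)`
points are of size `2 ^ (-M)`. -/
theorem exists_grid (hO : IsOpen (toHyperplane w ⁻¹' U)) {S : Set (Fin d → ℂ)} (hS : IsCompact S)
    (hSU : S ⊆ U) (hSw : ∀ z ∈ S, pair z w = 1) :
    ∃ (J : ℕ) (C : ℝ), 0 ≤ C ∧ ∀ M : ℕ, 0 < M → ∃ X : Finset (Fin d → ℂ),
      X.card ≤ J * M ^ d ∧ (∀ ζ ∈ X, ζ ∈ U) ∧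
      ∀ (h : (Fin d → ℂ) → ℂ) (B : ℝ), DifferentiableOn ℂ h U → (∀ z ∈ U, ‖h z‖ ≤ B) →
        (∀ ζ ∈ X, h ζ = 0) → ∀ z ∈ S, ‖h z‖ ≤ C * B / 2 ^ M := by
  classical
  have hSO : S ⊆ toHyperplane w ⁻¹' U := fun z hz => by
    rw [mem_preimage, toHyperplane_of_pair (hSw z hz)]
    exact hSU hz
  obtain ⟨r, hr, hrO⟩ := hS.exists_cthickening_subset_open hO hSO
  -- The radius for which the large polydiscs of `norm_le_of_zero_on_grid` have radius `r`.
  set ρ : ℝ := r / 2 ^ (d + 1) with hρ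
  have hρ0 : 0 < ρ := by positivity
  have hρr : 2 ^ (d + 1) * ρ = r := by rw [hρ]; field_simp
  obtain ⟨t, htS, htf, hcov⟩ := hS.finite_cover_balls hρ0
  refine ⟨htf.toFinset.card, 4 * d, by positivity, fun M hM => ?_⟩
  have hprim := Complex.isPrimitiveRoot_exp M hM.ne'
  have hball : ∀ a ∈ t, Metric.closedBall a (2 ^ (Fintype.card (Fin d) + 1) * ρ) ⊆
      toHyperplane w ⁻¹' U := by
    intro a ha
    rw [Fintype.card_fin, hρr]
    exact (Metric.closedBall_subset_cthickening (htS ha) r).trans hrO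
  refine ⟨(htf.toFinset ×ˢ Fintype.piFinset fun _ : Fin d =>
      Polynomial.nthRootsFinset M (1 : ℂ)).image
      fun q => toHyperplane w (q.1 + (ρ : ℂ) • q.2), ?_, ?_, ?_⟩
  · refine Finset.card_image_le.trans ?_
    rw [Finset.card_product, Fintype.card_piFinset]
    simp [hprim.card_nthRootsFinset]
  · intro ζ hζ
    obtain ⟨⟨a, ω⟩, hq, rfl⟩ := Finset.mem_image.1 hζ
    rw [Finset.mem_product, Fintype.mem_piFinset] at hq
    refine hball a (htf.mem_toFinset.1 hq.1) ?_
    simp only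
    rw [mem_closedBall_iff_norm, add_sub_cancel_left, norm_smul, Complex.norm_real,
      Real.norm_eq_abs, abs_of_pos hρ0, mul_comm]
    refine mul_le_mul_of_nonneg_right ?_ hρ0.le
    refine (pi_norm_le_iff_of_nonneg (by positivity)).2 fun i => ?_
    have := (Polynomial.mem_nthRootsFinset hM (1 : ℂ)).1 (hq.2 i)
    rw [Complex.norm_eq_one_of_pow_eq_one this hM.ne']
    exact one_le_pow₀ one_le_two
  · intro h B hh hB h0 z hz
    obtain ⟨a, ha, hza⟩ := mem_iUnion₂.1 (hcov hz)
    have := norm_le_of_zero_on_grid hM hρ0 (F := fun z => h (toHyperplane w z)) (a := a) (B := B)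
      ((differentiableOn_comp_toHyperplane hh).mono (hball a ha))
      (fun ζ hζ => hB _ (hball a ha hζ)) (fun ω hω => h0 _ (Finset.mem_image.2
        ⟨(a, ω), Finset.mem_product.2 ⟨htf.mem_toFinset.2 ha, Fintype.mem_piFinset.2 fun i =>
          (Polynomial.mem_nthRootsFinset hM (1 : ℂ)).2 (hω i)⟩, rfl⟩))
      (Metric.ball_subset_closedBall hza)
    simp only [toHyperplane_of_pair (hSw z hz), Fintype.card_fin] at this
    refine this.trans_eq ?_
    ring

end FastLyapunov

namespace FastLyapunov

variable {N d : ℕ} {T : Matrix (Fin N) (Fin N) ℕ} {U : Set (Fin d → ℂ)} {κ : ℕ → ℝ}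
  {w : Fin d → ℝ}

/-! ### Approximation of elements of `𝓑(U, κ)` by a finite-rank operator -/

theorem rank_smulRight_le {E : Type*} [NormedAddCommGroup E] [NormedSpace ℂ E] (μ : E →L[ℂ] ℂ)
    (e : E) : ((μ.smulRight e : E →L[ℂ] E) : E →ₗ[ℂ] E).rank ≤ 1 := by
  have h : LinearMap.range ((μ.smulRight e : E →L[ℂ] E) : E →ₗ[ℂ] E) ≤ Submodule.span ℂ {e} := by
    rintro _ ⟨v, rfl⟩
    exact Submodule.smul_mem _ _ (Submodule.mem_span_singleton_self e)
  refine (Submodule.rank_mono h).trans ((rank_span_le _).trans_eq ?_)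
  exact Cardinal.mk_singleton e

/-- The element `(x, z) ↦ 1_c(x) f(x₀, z)` of `𝓑(U, κ)`, for the cylinder `c` of points that start
with the word `c`. -/
noncomputable def cylinderFun (hκ : ∀ k, 0 < κ k) (hκa : Antitone κ)
    (hκ0 : Tendsto κ atTop (𝓝 0)) {n : ℕ}
    (c : Fin n → Fin N) (x₀ : SFT T) (f : BSpace T U κ) : BSpace T U κ :=
  BSpace.ofBounds hκ0
    (fun x z => if (fun i : Fin n => x.1 i) = c then f.toFun x₀ z else 0)
    (fun x z hz => by simp [f.toFun_of_notMem x₀ hz])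
    (fun x => by
      by_cases h : (fun i : Fin n => x.1 i) = c
      · simpa only [h, if_true] using f.differentiableOn x₀
      · simpa only [h, if_false] using differentiableOn_const 0)
    ‖f‖ (2 * ‖f‖ / κ n) (norm_nonneg f) (div_nonneg (by positivity) (hκ n).le)
    (fun x z hz => by
      split_ifs
      · exact f.norm_apply_le x₀ hz
      · rw [norm_zero]; exact norm_nonneg f)
    (fun k _ x y hxy z hz => by
      have hle : ∀ x : SFT T,
          ‖(if (fun i : Fin n => x.1 i) = c then f.toFun x₀ z else 0)‖ ≤ ‖f‖ := by
        intro x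
        split_ifs
        · exact f.norm_apply_le x₀ hz
        · rw [norm_zero]; exact norm_nonneg f
      rcases le_or_gt n k with hnk | hkn
      · have : (fun i : Fin n => x.1 i) = fun i : Fin n => y.1 i :=
          funext fun i => hxy i (i.2.trans_le hnk)
        rw [this, sub_self, norm_zero]
        exact mul_nonneg (div_nonneg (by positivity) (hκ n).le) (hκ k).le
      · refine (norm_sub_le _ _).trans ((add_le_add (hle x) (hle y)).trans ?_)
        rw [div_mul_eq_mul_div, le_div_iff₀ (hκ n), ← two_mul]
        exact mul_le_mul_of_nonneg_left (hκa hkn.le) (by positivity))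

theorem cylinderFun_toFun (hκ : ∀ k, 0 < κ k) (hκa : Antitone κ) (hκ0 : Tendsto κ atTop (𝓝 0))
    {n : ℕ} (c : Fin n → Fin N) (x₀ : SFT T) (f : BSpace T U κ) (x : SFT T) (z : Fin d → ℂ) :
    (cylinderFun hκ hκa hκ0 c x₀ f).toFun x z =
      if (fun i : Fin n => x.1 i) = c then f.toFun x₀ z else 0 := rfl

/-- Functions in `𝓑(U, κ)` that do not depend on the shift are approximated on a compact part of `U`
by an operator whose rank is polynomial in `M`, up to a relative error `M ^ d / 2 ^ M`. -/
theorem exists_holomorphic_approx (x₀ : SFT T)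
    (hO : IsOpen (toHyperplane w ⁻¹' U)) {S : Set (Fin d → ℂ)} (hS : IsCompact S)
    (hSU : S ⊆ U) (hSw : ∀ z ∈ S, pair z w = 1) :
    ∃ (J : ℕ) (C : ℝ), 0 ≤ C ∧ ∀ M : ℕ, 0 < M →
      ∃ (r : ℕ) (e : Fin r → BSpace T U κ) (μ : Fin r → BSpace T U κ →L[ℂ] ℂ), r ≤ J * M ^ d ∧
      ∀ g : BSpace T U κ, ∀ z ∈ S, ‖(g - ∑ j, μ j g • e j).toFun x₀ z‖ ≤
        C * (1 + 2 * (J * M ^ d : ℕ)) / 2 ^ M * ‖g‖ := by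
  obtain ⟨J, C, hC, hgrid⟩ := exists_grid hO hS hSU hSw
  refine ⟨J, C, hC, fun M hM => ?_⟩
  obtain ⟨X, hXcard, hXU, hX⟩ := hgrid M hM
  let Λ : BSpace T U κ →L[ℂ] (X → ℂ) := LinearMap.mkContinuous
    { toFun := fun f ζ => f.toFun x₀ ζ
      map_add' := fun _ _ => rfl
      map_smul' := fun _ _ => rfl } 1 fun f => by
    rw [one_mul]
    exact (pi_norm_le_iff_of_nonneg (norm_nonneg f)).2 fun ζ => f.norm_apply_le x₀ (hXU ζ ζ.2)
  obtain ⟨r, e, μ, hr, he, hμ, hΛ⟩ := exists_interpolation Λ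
  have hrle : r ≤ J * M ^ d := (hr.trans_eq (Fintype.card_coe X)).trans hXcard
  refine ⟨r, e, μ, hrle, fun g z hz => ?_⟩
  set p := ∑ j, μ j g • e j with hp
  have hpn : ‖p‖ ≤ 2 * (J * M ^ d : ℕ) * ‖g‖ := by
    calc ‖p‖ ≤ ∑ _j : Fin r, 2 * ‖g‖ := by
          refine norm_sum_le_of_le _ fun j _ => ?_
          rw [norm_smul]
          calc ‖μ j g‖ * ‖e j‖ ≤ 2 * ‖g‖ * 1 :=
                mul_le_mul (hμ j g) (he j) (norm_nonneg _) (by positivity)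
            _ = 2 * ‖g‖ := mul_one _
      _ = r * (2 * ‖g‖) := by simp
      _ ≤ (J * M ^ d : ℕ) * (2 * ‖g‖) := by gcongr
      _ = 2 * (J * M ^ d : ℕ) * ‖g‖ := by ring
  have hgp : ‖g - p‖ ≤ (1 + 2 * (J * M ^ d : ℕ)) * ‖g‖ := by
    refine (norm_sub_le _ _).trans ?_
    linarith
  have := hX ((g - p).toFun x₀) ‖g - p‖ ((g - p).differentiableOn x₀)
    (fun z hz => (g - p).norm_apply_le x₀ hz) (fun ζ hζ => ?_) z hz
  · refine this.trans ?_
    rw [div_mul_eq_mul_div, mul_assoc]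
    gcongr
  · have h1 := congrFun (hΛ g) ⟨ζ, hζ⟩
    change p.toFun x₀ ζ = g.toFun x₀ ζ at h1
    change g.toFun x₀ ζ - p.toFun x₀ ζ = 0
    rw [h1, sub_self]

/-- A finite-rank approximation of the identity: `f(x, ·)` is replaced by its value at
a representative of the cylinder of length `n` of `x`, and that holomorphic function by
an interpolation on a grid. -/
theorem exists_finiteRank_approx (x₀ : SFT T) (hκ : ∀ k, 0 < κ k) (hκa : Antitone κ)
    (hκ0 : Tendsto κ atTop (𝓝 0)) (hO : IsOpen (toHyperplane w ⁻¹' U)) {S : Set (Fin d → ℂ)}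
    (hS : IsCompact S) (hSU : S ⊆ U) (hSw : ∀ z ∈ S, pair z w = 1) :
    ∃ (J : ℕ) (C : ℝ), 0 ≤ C ∧ ∀ M n : ℕ, 0 < M → 1 ≤ n → ∃ Q : BSpace T U κ →L[ℂ] BSpace T U κ,
      (Q : BSpace T U κ →ₗ[ℂ] BSpace T U κ).rank ≤
        (((SFT.words T n).ncard * (J * M ^ d) : ℕ) : Cardinal) ∧
      ∀ δ : ℝ, δ = C * (1 + 2 * (J * M ^ d : ℕ)) / 2 ^ M → ∀ f : BSpace T U κ,
        (∀ x, ∀ z ∈ S, ‖(f - Q f).toFun x z‖ ≤ (κ n + δ) * ‖f‖) ∧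
        ∀ k, 1 ≤ k → ∀ x y, SFT.Agree k x y → ∀ z ∈ S,
          ‖(f - Q f).toFun x z - (f - Q f).toFun y z‖ ≤ (2 * κ (max k n) + δ * κ k) * ‖f‖ := by
  classical
  obtain ⟨J, C, hC, happ⟩ := exists_holomorphic_approx (T := T) (κ := κ) x₀ hO hS hSU hSw
  refine ⟨J, C, hC, fun M n hM hn => ?_⟩
  obtain ⟨r, e, μ, hr, hμ⟩ := happ M hM
  let word : SFT T → SFT.words T n := fun x => ⟨fun i => x.1 i, ⟨x, rfl⟩⟩
  choose rep hrep using fun c : SFT.words T n => c.2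
  have hrepx : ∀ x, SFT.Agree n x (rep (word x)) := fun x i hi =>
    (congrFun (hrep (word x)) ⟨i, hi⟩).symm
  let Q : BSpace T U κ →L[ℂ] BSpace T U κ := ∑ c : SFT.words T n, ∑ j,
    ((μ j).comp (BSpace.freeze hκ0 (rep c))).smulRight (cylinderFun hκ hκa hκ0 c.1 x₀ (e j))
  have hQ : ∀ f x z, (Q f).toFun x z =
      (∑ j, μ j (BSpace.freeze hκ0 (rep (word x)) f) • e j).toFun x₀ z := by
    intro f x z
    have h1 : Q f = ∑ c : SFT.words T n, ∑ j, μ j (BSpace.freeze hκ0 (rep c) f) •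
        cylinderFun hκ hκa hκ0 c.1 x₀ (e j) := by
      simp [Q]
    rw [h1, BSpace.toFun_sum, BSpace.toFun_sum, Finset.sum_apply, Finset.sum_apply,
      Finset.sum_apply, Finset.sum_apply, Finset.sum_eq_single (word x)]
    · rw [BSpace.toFun_sum, Finset.sum_apply, Finset.sum_apply]
      refine Finset.sum_congr rfl fun j _ => ?_
      rw [BSpace.toFun_smul, BSpace.toFun_smul]
      simp only [Pi.smul_apply]
      rw [cylinderFun_toFun, if_pos rfl]
    · intro c _ hc
      rw [BSpace.toFun_sum, Finset.sum_apply, Finset.sum_apply]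
      refine Finset.sum_eq_zero fun j _ => ?_
      rw [BSpace.toFun_smul]
      simp only [Pi.smul_apply]
      rw [cylinderFun_toFun, if_neg fun h => hc (Subtype.ext h.symm), smul_zero]
    · exact fun h => absurd (Finset.mem_univ _) h
  refine ⟨Q, ?_, ?_⟩
  · have hcoe : (Q : BSpace T U κ →ₗ[ℂ] BSpace T U κ) = ∑ c : SFT.words T n, ∑ j,
        ((((μ j).comp (BSpace.freeze hκ0 (rep c))).smulRight
          (cylinderFun hκ hκa hκ0 c.1 x₀ (e j)) : BSpace T U κ →L[ℂ] BSpace T U κ) :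
            BSpace T U κ →ₗ[ℂ] BSpace T U κ) := by
      simp [Q]
    rw [hcoe]
    calc _ ≤ ∑ c : SFT.words T n, ∑ j : Fin r, (1 : Cardinal) :=
          (LinearMap.rank_finsetSum_le _ _).trans (Finset.sum_le_sum fun c _ =>
            (LinearMap.rank_finsetSum_le _ _).trans (Finset.sum_le_sum fun j _ =>
              rank_smulRight_le _ _))
      _ = ((SFT.words T n).ncard * r : ℕ) := by
          simp [← Nat.card_coe_set_eq, Nat.card_eq_fintype_card]
      _ ≤ _ := by
          exact_mod_cast Nat.mul_le_mul_left _ hr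
  · rintro δ hδ f
    -- The error splits into those of freezing the shift and of approximating in `z`.
    have hdec : ∀ x z, (f - Q f).toFun x z =
        (f.toFun x z - f.toFun (rep (word x)) z) + (BSpace.freeze hκ0 (rep (word x)) f -
          ∑ j, μ j (BSpace.freeze hκ0 (rep (word x)) f) • e j).toFun x₀ z := by
      intro x z
      change f.toFun x z - (Q f).toFun x z = _ + (f.toFun (rep (word x)) z -
        (∑ j, μ j (BSpace.freeze hκ0 (rep (word x)) f) • e j).toFun x₀ z)
      rw [hQ]
      ring
    have hδ0 : 0 ≤ δ := by rw [hδ]; positivity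
    rw [← hδ] at hμ
    constructor
    · intro x z hz
      rw [hdec, add_mul]
      refine norm_add_le_of_le (f.norm_apply_sub_le hκ hn (hrepx x) (hSU hz)) ?_
      exact (hμ _ z hz).trans (mul_le_mul_of_nonneg_left (BSpace.norm_freeze_le hκ0 _ f) hδ0)
    · intro k hk x y hxy z hz
      -- For `n ≤ k` the approximations at `x` and `y` coincide. For `k < n` the representatives of
      -- the two cylinders agree in `k` symbols.
      rcases le_or_gt n k with hnk | hkn
      · have hw : word x = word y :=
          Subtype.ext (funext fun i => hxy i (i.2.trans_le hnk))
        rw [hdec, hdec, hw, max_eq_left hnk]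
        have h1 := f.norm_apply_sub_le hκ hk hxy (hSU hz)
        have h2 : 0 ≤ κ k * ‖f‖ := mul_nonneg (hκ k).le (norm_nonneg f)
        have h3 : 0 ≤ δ * (κ k * ‖f‖) := mul_nonneg hδ0 h2
        have e1 : ∀ a b c q : ℂ, a - c + q - (b - c + q) = a - b := fun a b c q => by ring
        rw [e1]
        refine h1.trans ?_
        linarith
      · rw [hdec, hdec, max_eq_right hkn.le]
        set gx := BSpace.freeze hκ0 (rep (word x)) f
        set gy := BSpace.freeze hκ0 (rep (word y)) f
        have hxy' : SFT.Agree k (rep (word x)) (rep (word y)) := fun i hi =>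
          ((hrepx x i (hi.trans hkn)).symm.trans (hxy i hi)).trans (hrepx y i (hi.trans hkn))
        have h1 := f.norm_apply_sub_le hκ hn (hrepx x) (hSU hz)
        have h2 := f.norm_apply_sub_le hκ hn (hrepx y) (hSU hz)
        have h3 := (hμ (gx - gy) z hz).trans
          (mul_le_mul_of_nonneg_left (BSpace.norm_freeze_sub_le hκ hκ0 hk hxy' f) hδ0)
        have e1 : (gx - ∑ j, μ j gx • e j) - (gy - ∑ j, μ j gy • e j) =
            (gx - gy) - ∑ j, μ j (gx - gy) • e j := by
          simp only [map_sub, sub_smul, Finset.sum_sub_distrib]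
          abel
        rw [← e1] at h3
        change ‖(gx - ∑ j, μ j gx • e j).toFun x₀ z - (gy - ∑ j, μ j gy • e j).toFun x₀ z‖ ≤ _ at h3
        have e2 : ∀ a b a' b' : ℂ, a + b - (a' + b') = (a - a') + (b - b') := fun a b a' b' => by
          ring
        rw [e2]
        refine (norm_add_le_of_le (norm_sub_le_of_le h1 h2) h3).trans ?_
        linarith

/-! ### Approximation numbers of powers -/

theorem rank_pow_sub_pow_le {E : Type*} [NormedAddCommGroup E] [NormedSpace ℂ E]
    (L F : E →L[ℂ] E) (q : ℕ) :
    ((L ^ q - (L - F) ^ q : E →L[ℂ] E) : E →ₗ[ℂ] E).rank ≤ q * (F : E →ₗ[ℂ] E).rank := by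
  induction q with
  | zero => simp
  | succ q ih =>
    have e : (L ^ (q + 1) - (L - F) ^ (q + 1) : E →L[ℂ] E) =
        (L ^ q - (L - F) ^ q) * L + (L - F) ^ q * F := by
      rw [pow_succ, pow_succ]
      noncomm_ring
    have e' : ((L ^ (q + 1) - (L - F) ^ (q + 1) : E →L[ℂ] E) : E →ₗ[ℂ] E) =
        ((L ^ q - (L - F) ^ q : E →L[ℂ] E) : E →ₗ[ℂ] E).comp (L : E →ₗ[ℂ] E) +
          (((L - F) ^ q : E →L[ℂ] E) : E →ₗ[ℂ] E).comp (F : E →ₗ[ℂ] E) := by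
      rw [e]
      rfl
    rw [e']
    refine (LinearMap.rank_add_le _ _).trans ?_
    rw [Nat.cast_succ, add_mul, one_mul]
    exact add_le_add ((LinearMap.rank_comp_le_left _ _).trans ih) (LinearMap.rank_comp_le_right _ _)

/-- Powers of an operator inherit approximations: the error is raised to the power `q`, the rank
is multiplied by `q`. -/
theorem approxNumber_pow_le {E : Type*} [NormedAddCommGroup E] [NormedSpace ℂ E]
    (L F : E →L[ℂ] E) {q r n : ℕ} (hq : 1 ≤ q) (hF : (F : E →ₗ[ℂ] E).rank ≤ (r : Cardinal))
    (hn : q * r < n) : approxNumber n (L ^ q) ≤ ‖L - F‖ ^ q := by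
  have h1 : approxNumber n (L ^ q) ≤ ‖L ^ q - (L ^ q - (L - F) ^ q)‖ := by
    refine csInf_le ⟨0, ?_⟩ ⟨_, ?_, rfl⟩
    · rintro _ ⟨G, -, rfl⟩
      exact norm_nonneg _
    · refine (rank_pow_sub_pow_le L F q).trans_lt ?_
      calc (q : Cardinal) * (F : E →ₗ[ℂ] E).rank ≤ q * r := by gcongr
        _ = ((q * r : ℕ) : Cardinal) := by push_cast; rfl
        _ < n := by exact_mod_cast hn
  rw [sub_sub_cancel] at h1
  exact h1.trans (norm_pow_le' _ hq)

theorem approxNumber_le_norm {E : Type*} [NormedAddCommGroup E] [NormedSpace ℂ E]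
    (L : E →L[ℂ] E) {n : ℕ} (hn : 1 ≤ n) : approxNumber n L ≤ ‖L‖ := by
  refine csInf_le ⟨0, ?_⟩ ⟨0, ?_, by rw [sub_zero]⟩
  · rintro _ ⟨G, -, rfl⟩
    exact norm_nonneg _
  · have : ((0 : E →L[ℂ] E) : E →ₗ[ℂ] E) = 0 := rfl
    rw [this, LinearMap.rank_zero]
    exact_mod_cast hn

end FastLyapunov

namespace FastLyapunov

/-! ### Regularity of the weight and of the projective action -/

theorem locallyLipschitzOn_of_contDiffAt {𝕜 E F : Type*} [RCLike 𝕜] [NormedAddCommGroup E]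
    [NormedSpace 𝕜 E] [NormedAddCommGroup F] [NormedSpace 𝕜 F] {h : E → F} {Q : Set E}
    (hh : ∀ x ∈ Q, ContDiffAt 𝕜 1 h x) : LocallyLipschitzOn Q h := fun x hx => by
  obtain ⟨K, t, ht, hK⟩ := (hh x hx).exists_lipschitzOnWith
  exact ⟨K, t, mem_nhdsWithin_of_mem_nhds ht, hK⟩

theorem sq_mem_slitPlane {ζ : ℂ} (h : ζ.re ≠ 0) : ζ ^ 2 ∈ Complex.slitPlane := by
  rw [Complex.mem_slitPlane_iff, sq, Complex.mul_re, Complex.mul_im]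
  rcases eq_or_ne ζ.im 0 with h0 | h0
  · left
    rw [h0]
    have := mul_self_pos.2 h
    linarith
  · right
    intro h1
    have : ζ.re * ζ.im = 0 := by linarith
    exact mul_ne_zero h h0 this

theorem abs_apply_le_norm_toEuclideanCLM {d : ℕ} (B : Matrix (Fin d) (Fin d) ℝ) (i j : Fin d) :
    |B i j| ≤ ‖Matrix.toEuclideanCLM (𝕜 := ℝ) B‖ := by
  have h1 := (Matrix.toEuclideanCLM (𝕜 := ℝ) B).le_opNorm (EuclideanSpace.single j 1)
  have h2 := PiLp.norm_apply_le
    (Matrix.toEuclideanCLM (𝕜 := ℝ) B (EuclideanSpace.single j (1 : ℝ))) i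
  rw [PiLp.norm_single, norm_one, mul_one] at h1
  refine le_trans ?_ (h2.trans h1)
  have h3 : (Matrix.toEuclideanCLM (𝕜 := ℝ) B (EuclideanSpace.single j (1 : ℝ))) i = B i j := by
    change (B *ᵥ (EuclideanSpace.single j (1 : ℝ)).ofLp) i = B i j
    simp
  rw [h3, Real.norm_eq_abs]

theorem continuous_act (d : ℕ) : Continuous fun q : Matrix (Fin d) (Fin d) ℝ × (Fin d → ℂ) =>
    act q.1 q.2 := by
  refine continuous_pi fun k => ?_
  unfold act mulVec dotProduct
  simp only [map_apply]
  refine continuous_finsetSum _ fun j _ => ?_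
  exact (Complex.continuous_ofReal.comp (continuous_fst.matrix_elem k j)).mul
    ((continuous_apply j).comp continuous_snd)

theorem differentiable_act {d : ℕ} (A : Matrix (Fin d) (Fin d) ℝ) : Differentiable ℂ (act A) := by
  refine differentiable_pi.2 fun k => ?_
  unfold act mulVec dotProduct
  fun_prop

variable {N d m : ℕ} {T : Matrix (Fin N) (Fin N) ℕ} {κ : ℕ → ℝ} {w : Fin d → ℝ}
  {U : Set (Fin d → ℂ)}

theorem differentiableOn_proj {A : Matrix (Fin d) (Fin d) ℝ}
    (hA : ∀ z ∈ U, pair (act A z) w ≠ 0) : DifferentiableOn ℂ (proj w A) U := by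
  unfold proj
  have h := (differentiable_pair w).comp (differentiable_act A)
  exact (h.differentiableOn.fun_inv hA).smul (differentiable_act A).differentiableOn

theorem differentiableOn_weight {A : Matrix (Fin d) (Fin d) ℝ} {ℓ : (Fin d → ℂ) → ℂ}
    (hℓ : DifferentiableOn ℂ ℓ U) (β : ℝ) (hA : ∀ z ∈ U, (pair (act A z) w).re ≠ 0)
    (hm : MapsTo (proj w A) U U) : DifferentiableOn ℂ (weight w ℓ β A) U := by
  have h : DifferentiableOn ℂ (fun z => pair (act A z) w) U :=
    ((differentiable_pair w).comp (differentiable_act A)).differentiableOn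
  have hp := differentiableOn_proj (w := w) (U := U) (A := A) fun z hz h0 =>
    hA z hz (by rw [h0, Complex.zero_re])
  unfold weight
  refine DifferentiableOn.mul ?_ ?_
  · exact (h.fun_pow 2).cpow_const fun z hz => sq_mem_slitPlane (hA z hz)
  · exact (((hℓ.comp hp hm).sub hℓ).const_mul (β : ℂ)).cexp

theorem isKernel_entry (hκ : ∀ k, 0 < κ k) {A : SFT T → GL (Fin d) ℝ} (hA : Continuous A)
    (hvar : SFT.VarBigO
      (fun x => Matrix.toEuclideanCLM (𝕜 := ℝ) (A x : Matrix (Fin d) (Fin d) ℝ)) κ) (i j : Fin d) :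
    IsKernel U κ fun (y : SFT T) _ => (((A y : Matrix (Fin d) (Fin d) ℝ) i j : ℝ) : ℂ) := by
  obtain ⟨M, hM0, hM⟩ := hvar.exists_dist_le hκ
  have hc : Continuous fun y => (A y : Matrix (Fin d) (Fin d) ℝ) i j :=
    (Units.continuous_val.comp hA).matrix_elem i j
  obtain ⟨C, hC⟩ := isCompact_univ.exists_bound_of_continuousOn hc.continuousOn
  refine ⟨max C M, hM0.trans (le_max_right _ _), fun y z _ => ?_, fun k hk y y' hy z _ => ?_⟩
  · rw [Complex.norm_real]
    exact (hC y (mem_univ y)).trans (le_max_left _ _)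
  · rw [← Complex.ofReal_sub, Complex.norm_real, Real.norm_eq_abs]
    refine le_trans ?_ ((hM k hk y y' hy).trans
      (mul_le_mul_of_nonneg_right (le_max_right _ _) (hκ k).le))
    rw [dist_eq_norm, ← map_sub]
    exact abs_apply_le_norm_toEuclideanCLM
      ((A y : Matrix (Fin d) (Fin d) ℝ) - (A y' : Matrix (Fin d) (Fin d) ℝ)) i j

theorem isKernel_exp_potential (hκ : ∀ k, 0 < κ k) (hκ0 : Tendsto κ atTop (𝓝 0)) {φ : SFT T → ℝ}
    (hφ : SFT.VarBigO φ κ) : IsKernel U κ fun (y : SFT T) _ => Complex.exp (φ y) := by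
  obtain ⟨M, hM0, hM⟩ := hφ.exists_dist_le hκ
  have hc : Continuous φ := SFT.continuous_of_var_tendsto (b := fun k => M * κ k)
    (by simpa using hκ0.const_mul M) hM
  obtain ⟨C, hC⟩ := isCompact_univ.exists_bound_of_continuousOn hc.continuousOn
  have hker : IsKernel U κ fun (y : SFT T) _ => φ y := by
    refine ⟨max C M, hM0.trans (le_max_right _ _), fun y z _ =>
      (hC y (mem_univ y)).trans (le_max_left _ _), fun k hk y y' hy z _ => ?_⟩
    rw [← dist_eq_norm]
    exact (hM k hk y y' hy).trans (mul_le_mul_of_nonneg_right (le_max_right _ _) (hκ k).le)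
  refine hker.comp_of_isCompact hκ (isCompact_range hc) (fun y _ _ => mem_range_self y)
    (h := fun t : ℝ => Complex.exp t) ?_
  refine locallyLipschitzOn_of_contDiffAt (𝕜 := ℝ) fun x _ => ?_
  exact (Complex.contDiff_exp.comp Complex.ofRealCLM.contDiff).contDiffAt

/-- The weight and the projective action are holomorphic, have rapidly decaying variations, and
the projective action maps `U` into a compact part of `U`. -/
theorem exists_kernel_data (hκ : ∀ k, 0 < κ k) (hκ0 : Tendsto κ atTop (𝓝 0))
    {φ : SFT T → ℝ} {A : SFT T → GL (Fin d) ℝ} {K : Fin m → Set (Fin d → ℝ)} (hA : HypH1 A K w)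
    {β : ℝ} {ν : Seminorm ℝ (Fin d → ℝ)} {ℓ : (Fin d → ℂ) → ℂ}
    (hℓ : IsLogNorm (domain K w) β ν ℓ) (hφ : SFT.VarBigO φ κ)
    (hvar : SFT.VarBigO
      (fun x => Matrix.toEuclideanCLM (𝕜 := ℝ) (A x : Matrix (Fin d) (Fin d) ℝ)) κ) :
    ∃ S : Set (Fin d → ℂ), IsCompact S ∧ S ⊆ domain K w ∧
      (∀ y, ∀ z ∈ domain K w, proj w (A y : Matrix (Fin d) (Fin d) ℝ) z ∈ S) ∧
      (∀ y, DifferentiableOn ℂ (proj w (A y : Matrix (Fin d) (Fin d) ℝ)) (domain K w)) ∧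
      (∀ y, DifferentiableOn ℂ (weight w ℓ β (A y : Matrix (Fin d) (Fin d) ℝ)) (domain K w)) ∧
      IsKernel (domain K w) κ (fun y => proj w (A y : Matrix (Fin d) (Fin d) ℝ)) ∧
      IsKernel (domain K w) κ (fun y z =>
        Complex.exp (φ y) * weight w ℓ β (A y : Matrix (Fin d) (Fin d) ℝ) z) := by
  set U := domain K w with hU
  have hw := hA.isMulticone.unit
  have hO := isOpen_preimage_domain hw K
  obtain ⟨W, hWc, hUW, hW⟩ := hA.isMulticone.exists_compact_hull
  have hWre : ∀ y, ∀ z ∈ W, (pair (act (A y : Matrix (Fin d) (Fin d) ℝ) z) w).re ≠ 0 :=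
    fun y z hz => (hW _ ⟨y, rfl⟩ z hz).1
  have hWne : ∀ y, ∀ z ∈ W, pair (act (A y : Matrix (Fin d) (Fin d) ℝ) z) w ≠ 0 :=
    fun y z hz h0 => hWre y z hz (by rw [h0, Complex.zero_re])
  have hcact : Continuous fun q : SFT T × (Fin d → ℂ) =>
      act (A q.1 : Matrix (Fin d) (Fin d) ℝ) q.2 :=
    (continuous_act d).comp (((Units.continuous_val.comp hA.continuous).comp
      continuous_fst).prodMk continuous_snd)
  have hcpair : Continuous fun q : SFT T × (Fin d → ℂ) =>
      pair (act (A q.1 : Matrix (Fin d) (Fin d) ℝ) q.2) w := (continuous_pair w).comp hcact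
  have hprod : IsCompact ((univ : Set (SFT T)) ×ˢ W) := isCompact_univ.prod hWc
  -- The compact sets in which the values of the action and of `⟨A z, w⟩` lie.
  set S := (fun q : SFT T × (Fin d → ℂ) => proj w (A q.1 : Matrix (Fin d) (Fin d) ℝ) q.2) ''
    (univ ×ˢ W) with hS
  set R := (fun q : SFT T × (Fin d → ℂ) => pair (act (A q.1 : Matrix (Fin d) (Fin d) ℝ) q.2) w) ''
    (univ ×ˢ W) with hR
  have hSc : IsCompact S := by
    refine hprod.image_of_continuousOn ?_
    exact (hcpair.continuousOn.inv₀ fun q hq => hWne q.1 q.2 hq.2).smul hcact.continuousOn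
  have hRc : IsCompact R := hprod.image hcpair
  have hRre : ∀ ζ ∈ R, ζ.re ≠ 0 := by
    rintro _ ⟨q, hq, rfl⟩
    exact hWre q.1 q.2 hq.2
  have hRmem : ∀ y, ∀ z ∈ U, pair (act (A y : Matrix (Fin d) (Fin d) ℝ) z) w ∈ R :=
    fun y z hz => ⟨(y, z), ⟨mem_univ _, hUW hz⟩, rfl⟩
  have hSmem : ∀ y, ∀ z ∈ U, proj w (A y : Matrix (Fin d) (Fin d) ℝ) z ∈ S :=
    fun y z hz => ⟨(y, z), ⟨mem_univ _, hUW hz⟩, rfl⟩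
  have hSU : S ⊆ U := by
    rintro _ ⟨q, hq, rfl⟩
    exact (hW _ ⟨q.1, rfl⟩ q.2 hq.2).2
  have hSw : ∀ z ∈ S, pair z w = 1 := fun z hz => pair_of_mem_domain (hSU hz)
  have hcoord : ∀ j : Fin d, IsKernel U κ fun (_ : SFT T) z => z j := by
    intro j
    obtain ⟨C, hC⟩ := hWc.exists_bound_of_continuousOn (continuous_apply j).continuousOn
    exact IsKernel.of_bounded hκ (g := fun z : Fin d → ℂ => z j) fun z hz => hC z (hUW hz)
  have hact : ∀ k : Fin d, IsKernel U κ fun (y : SFT T) z =>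
      act (A y : Matrix (Fin d) (Fin d) ℝ) z k := fun k =>
    IsKernel.sum hκ Finset.univ fun j _ =>
      (isKernel_entry hκ hA.continuous hvar k j).mul hκ (hcoord j)
  have hpair : IsKernel U κ fun (y : SFT T) z =>
      pair (act (A y : Matrix (Fin d) (Fin d) ℝ) z) w :=
    IsKernel.sum hκ Finset.univ fun j _ => (hact j).mul hκ
      (IsKernel.of_bounded hκ (g := fun _ => toC w j) (C := ‖toC w j‖) fun _ _ => le_rfl)
  have hinv : IsKernel U κ fun (y : SFT T) z =>
      (pair (act (A y : Matrix (Fin d) (Fin d) ℝ) z) w)⁻¹ :=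
    hpair.comp_of_isCompact hκ hRc hRmem (h := fun ζ => ζ⁻¹)
      (locallyLipschitzOn_of_contDiffAt (𝕜 := ℂ) fun ζ hζ =>
        contDiffAt_inv ℂ fun h0 => hRre ζ hζ (by rw [h0, Complex.zero_re]))
  have hproj : IsKernel U κ fun (y : SFT T) => proj w (A y : Matrix (Fin d) (Fin d) ℝ) :=
    IsKernel.pi hκ fun k => hinv.mul hκ (hact k)
  have hpow : IsKernel U κ fun (y : SFT T) z =>
      (pair (act (A y : Matrix (Fin d) (Fin d) ℝ) z) w ^ 2) ^ ((β : ℂ) / 2) :=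
    hpair.comp_of_isCompact hκ hRc hRmem (h := fun ζ => (ζ ^ 2) ^ ((β : ℂ) / 2))
      (locallyLipschitzOn_of_contDiffAt (𝕜 := ℂ) fun ζ hζ =>
        ((analyticAt_id.pow 2).cpow analyticAt_const (sq_mem_slitPlane (hRre ζ hζ))).contDiffAt)
  have hexp : IsKernel U κ fun (y : SFT T) z =>
      Complex.exp ((β : ℂ) * ℓ (proj w (A y : Matrix (Fin d) (Fin d) ℝ) z)) := by
    have hSO : S ⊆ toHyperplane w ⁻¹' U := fun z hz => by
      rw [mem_preimage, toHyperplane_of_pair (hSw z hz)]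
      exact hSU hz
    obtain ⟨r, hr, hrO⟩ := hSc.exists_cthickening_subset_open hO hSO
    have hd : DifferentiableOn ℂ (fun z => Complex.exp ((β : ℂ) * ℓ (toHyperplane w z)))
        (Metric.cthickening r S) :=
      ((differentiableOn_comp_toHyperplane hℓ.holomorphic).mono hrO).const_mul (β : ℂ) |>.cexp
    obtain ⟨a, ha⟩ := (hSc.cthickening (r := r)).exists_bound_of_continuousOn hd.continuousOn
    refine hproj.comp hκ hSmem (h := fun ζ => Complex.exp ((β : ℂ) * ℓ ζ))
      (C := max a (2 * a / r)) (fun ζ hζ => ?_) fun ζ hζ ζ' hζ' => ?_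
    · have := ha ζ (Metric.self_subset_cthickening S hζ)
      rw [toHyperplane_of_pair (hSw ζ hζ)] at this
      exact this.trans (le_max_left _ _)
    · have := norm_sub_le_of_cthickening hr hd ha hζ hζ'
      rw [toHyperplane_of_pair (hSw ζ hζ), toHyperplane_of_pair (hSw ζ' hζ')] at this
      exact this.trans (mul_le_mul_of_nonneg_right (le_max_right _ _) (norm_nonneg _))
  obtain ⟨B, hB⟩ := hℓ.bounded
  have hexp' : IsKernel U κ fun (_ : SFT T) z => Complex.exp (-(β : ℂ) * ℓ z) :=
    IsKernel.of_bounded hκ hB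
  refine ⟨S, hSc, hSU, hSmem, fun y => differentiableOn_proj fun z hz => hWne y z (hUW hz),
    fun y => differentiableOn_weight hℓ.holomorphic β (fun z hz => hWre y z (hUW hz))
      fun z hz => hSU (hSmem y z hz), hproj, ?_⟩
  have := (isKernel_exp_potential (U := U) hκ hκ0 hφ).mul hκ (hpow.mul hκ (hexp.mul hκ hexp'))
  convert this using 5 with y z
  rw [← Complex.exp_add, weight, mul_sub, neg_mul, ← sub_eq_add_neg]

end FastLyapunov

namespace FastLyapunov

variable {N d : ℕ} {T : Matrix (Fin N) (Fin N) ℕ} {U : Set (Fin d → ℂ)} {κ : ℕ → ℝ}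
  {w : Fin d → ℝ}

/-! ### The transfer operator and its finite-rank approximations -/

/-- A transfer operator with holomorphic kernels of rapidly decaying variations is bounded on
`𝓑(U, κ)`, and is approximated by operators of rank `W_n J M ^ d`, where `W_n` is the number of
words of length `n`. The operator gains one symbol, which turns the variations of index
`max (k + 1) n` of the approximation error into `κ_k θ_n`. -/
theorem exists_transfer_approx (x₀ : SFT T) (hκ : ∀ k, 0 < κ k) (hκa : Antitone κ)
    (hκ1 : ∀ k, κ k ≤ 1) (hκ0 : Tendsto κ atTop (𝓝 0)) {θ : ℕ → ℝ}
    (hθ : ∀ k n, 1 ≤ k → 2 ≤ n → κ (max (k + 1) n) ≤ κ k * θ n)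
    (hO : IsOpen (toHyperplane w ⁻¹' U)) (hw : w ⬝ᵥ w = 1) (hUw : ∀ z ∈ U, pair z w = 1)
    {G : SFT T → (Fin d → ℂ) → ℂ} {τ : SFT T → (Fin d → ℂ) → Fin d → ℂ}
    (hG : IsKernel U κ G) (hτ : IsKernel U κ τ) (hGd : ∀ y, DifferentiableOn ℂ (G y) U)
    (hτd : ∀ y, DifferentiableOn ℂ (τ y) U) {S : Set (Fin d → ℂ)} (hS : IsCompact S)
    (hSU : S ⊆ U) (hτS : ∀ y, ∀ z ∈ U, τ y z ∈ S) :
    ∃ L : BSpace T U κ →L[ℂ] BSpace T U κ,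
      (∀ f : BSpace T U κ, ∀ x, ∀ z ∈ U, (L f).toFun x z = sumPreimages G τ f.toFun x z) ∧
      ∃ (J : ℕ) (C C' : ℝ), 0 ≤ C ∧ 0 ≤ C' ∧ ∀ M n : ℕ, 0 < M → 2 ≤ n →
        ∃ F : BSpace T U κ →L[ℂ] BSpace T U κ,
          (F : BSpace T U κ →ₗ[ℂ] BSpace T U κ).rank ≤
            (((SFT.words T n).ncard * (J * M ^ d) : ℕ) : Cardinal) ∧
          ‖L - F‖ ≤ C * (θ n + C' * (1 + 2 * (J * M ^ d : ℕ)) / 2 ^ M) := by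
  classical
  have hSw : ∀ z ∈ S, pair z w = 1 := fun z hz => hUw z (hSU hz)
  have hSO : S ⊆ toHyperplane w ⁻¹' U := fun z hz => by
    rw [mem_preimage, toHyperplane_of_pair (hSw z hz)]
    exact hSU hz
  obtain ⟨r, hr, hrO⟩ := hS.exists_cthickening_subset_open hO hSO
  set S' := toHyperplane w '' Metric.cthickening r S with hS'
  have hS'c : IsCompact S' := hS.cthickening.image (differentiable_toHyperplane w).continuous
  have hS'U : S' ⊆ U := by
    rintro _ ⟨z, hz, rfl⟩
    exact hrO hz
  have hS'w : ∀ z ∈ S', pair z w = 1 := by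
    rintro _ ⟨z, -, rfl⟩
    exact pair_toHyperplane hw z
  obtain ⟨C, hC, hbound⟩ := sumPreimages_bounds hκ hG hτ hr hrO hSw hτS
  have hτU : ∀ y, MapsTo (τ y) U U := fun y z hz => hSU (hτS y z hz)
  have hdiff : ∀ f : BSpace T U κ, ∀ x, DifferentiableOn ℂ (sumPreimages G τ f.toFun x) U :=
    fun f x => differentiableOn_sumPreimages hGd hτd hτU f.differentiableOn x
  have hbasic : ∀ f : BSpace T U κ,
      (∀ x, ∀ z ∈ U, ‖sumPreimages G τ f.toFun x z‖ ≤ C * ‖f‖) ∧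
      ∀ k, 1 ≤ k → ∀ x x', SFT.Agree k x x' → ∀ z ∈ U,
        ‖sumPreimages G τ f.toFun x z - sumPreimages G τ f.toFun x' z‖ ≤
          2 * C * ‖f‖ * κ k := by
    intro f
    obtain ⟨h1, h2⟩ := hbound f.toFun f.differentiableOn ‖f‖ (fun k => κ k * ‖f‖)
      (fun y ζ hζ => f.norm_apply_le y (hS'U hζ))
      (fun k hk y y' hy ζ hζ => f.norm_apply_sub_le hκ hk hy (hS'U hζ))
    refine ⟨h1, fun k hk x x' hx z hz => (h2 k hk x x' hx z hz).trans ?_⟩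
    have h3 : κ (k + 1) * ‖f‖ ≤ κ k * ‖f‖ :=
      mul_le_mul_of_nonneg_right (hκa (Nat.le_succ k)) (norm_nonneg f)
    nlinarith
  let Lf : BSpace T U κ → BSpace T U κ := fun f => BSpace.ofBounds hκ0
    (fun x z => if z ∈ U then sumPreimages G τ f.toFun x z else 0)
    (fun x z hz => if_neg hz)
    (fun x => (hdiff f x).congr fun z hz => if_pos hz)
    (C * ‖f‖) (2 * C * ‖f‖) (by positivity) (by positivity)
    (fun x z hz => by simpa only [if_pos hz] using (hbasic f).1 x z hz)
    (fun k hk x y hxy z hz => by simpa only [if_pos hz] using (hbasic f).2 k hk x y hxy z hz)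
  have hLf : ∀ f x z, z ∈ U → (Lf f).toFun x z = sumPreimages G τ f.toFun x z :=
    fun f x z hz => if_pos hz
  let L₀ : BSpace T U κ →ₗ[ℂ] BSpace T U κ :=
    { toFun := Lf
      map_add' := fun f g => BSpace.toFun_injective <| funext fun x => funext fun z => by
        by_cases hz : z ∈ U
        · change (Lf (f + g)).toFun x z = (Lf f).toFun x z + (Lf g).toFun x z
          rw [hLf _ _ _ hz, hLf _ _ _ hz, hLf _ _ _ hz, sumPreimages, sumPreimages, sumPreimages,
            ← Finset.sum_add_distrib]
          refine Finset.sum_congr rfl fun i _ => ?_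
          rw [BSpace.toFun_add, Pi.add_apply, Pi.add_apply, mul_add]
        · rw [BSpace.toFun_of_notMem _ _ hz, BSpace.toFun_of_notMem _ _ hz]
      map_smul' := fun c f => BSpace.toFun_injective <| funext fun x => funext fun z => by
        by_cases hz : z ∈ U
        · change (Lf (c • f)).toFun x z = c * (Lf f).toFun x z
          rw [hLf _ _ _ hz, hLf _ _ _ hz, sumPreimages, sumPreimages, Finset.mul_sum]
          refine Finset.sum_congr rfl fun i _ => ?_
          rw [BSpace.toFun_smul, Pi.smul_apply, Pi.smul_apply, smul_eq_mul, mul_left_comm]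
        · rw [BSpace.toFun_of_notMem _ _ hz, BSpace.toFun_of_notMem _ _ hz] }
  -- `C ‖f‖` bounds the supremum and `2 C ‖f‖` the variations.
  let L : BSpace T U κ →L[ℂ] BSpace T U κ := L₀.mkContinuous (C + 2 * C) fun f => by
    rw [add_mul]
    refine BSpace.norm_le_of_bounds (Lf f) (by positivity) (by positivity) ?_ ?_
    · intro x z hz
      rw [hLf f x z hz]
      exact (hbasic f).1 x z hz
    · intro k hk x y hxy z hz
      rw [hLf f x z hz, hLf f y z hz]
      exact (hbasic f).2 k hk x y hxy z hz
  have hL : ∀ f x z, z ∈ U → (L f).toFun x z = sumPreimages G τ f.toFun x z := hLf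
  obtain ⟨J, C', hC', happ⟩ := exists_finiteRank_approx (κ := κ) x₀ hκ hκa hκ0 hO hS'c hS'U hS'w
  refine ⟨L, fun f x z hz => hL f x z hz, J, 4 * C, C', by positivity, hC', fun M n hM hn => ?_⟩
  obtain ⟨Q, hQr, hQ⟩ := happ M n hM (by omega)
  obtain ⟨δ, hδ⟩ : ∃ δ, δ = C' * (1 + 2 * (J * M ^ d : ℕ)) / 2 ^ M := ⟨_, rfl⟩
  have hδ0 : 0 ≤ δ := by rw [hδ]; positivity
  have hκθ : κ n ≤ θ n := by
    have h1 := hθ 1 n le_rfl hn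
    rw [max_eq_right hn] at h1
    have h2 := hκ n
    have hθ0 : 0 ≤ θ n := by
      by_contra! h3
      nlinarith [hκ 1]
    nlinarith [hκ1 1]
  have hθ0 : 0 ≤ θ n := (hκ n).le.trans hκθ
  refine ⟨L.comp Q, (LinearMap.rank_comp_le_right (Q : BSpace T U κ →ₗ[ℂ] BSpace T U κ)
    (L : BSpace T U κ →ₗ[ℂ] BSpace T U κ)).trans hQr, ?_⟩
  rw [← hδ]
  refine ContinuousLinearMap.opNorm_le_bound _ (by positivity) fun f => ?_
  have he : (L - L.comp Q) f = L (f - Q f) := by simp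
  rw [he]
  obtain ⟨hq1, hq2⟩ := hQ δ hδ f
  obtain ⟨h1, h2⟩ := hbound (f - Q f).toFun (f - Q f).differentiableOn ((κ n + δ) * ‖f‖)
    (fun k => (2 * κ (max k n) + δ * κ k) * ‖f‖) hq1 hq2
  have hfin : ‖L (f - Q f)‖ ≤ C * ((κ n + δ) * ‖f‖) + C * ((κ n + 2 * θ n + 2 * δ) * ‖f‖) := by
    have hκn := (hκ n).le
    refine BSpace.norm_le_of_bounds _ (by positivity) (by positivity) ?_ ?_
    · intro x z hz
      rw [hL _ x z hz]
      exact h1 x z hz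
    · intro k hk x y hxy z hz
      rw [hL _ x z hz, hL _ y z hz]
      refine (h2 k hk x y hxy z hz).trans ?_
      rw [mul_assoc C]
      refine mul_le_mul_of_nonneg_left ?_ hC
      have e1 : κ (k + 1) ≤ κ k := hκa (Nat.le_succ k)
      have e2 := hθ k n hk hn
      have e3 : κ (k + 1) * (κ n + δ) ≤ κ k * (κ n + δ) :=
        mul_le_mul_of_nonneg_right e1 (by positivity)
      have e4 : δ * κ (k + 1) ≤ δ * κ k := mul_le_mul_of_nonneg_left e1 hδ0
      have e5 : κ (k + 1) * (κ n + δ) + (2 * κ (max (k + 1) n) + δ * κ (k + 1)) ≤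
          (κ n + 2 * θ n + 2 * δ) * κ k := by linarith
      have := mul_le_mul_of_nonneg_right e5 (norm_nonneg f)
      linarith
  refine hfin.trans ?_
  have e6 : 0 ≤ C * ‖f‖ := by positivity
  nlinarith

/-! ### Asymptotics -/

/-- The gap between consecutive values of `x ↦ x ^ p`, by Bernoulli's inequality. -/
theorem rpow_add_le_add_one_rpow {p : ℝ} (hp : 1 ≤ p) {x : ℝ} (hx : 0 < x) :
    x ^ p + p * x ^ (p - 1) ≤ (x + 1) ^ p := by
  have h := one_add_mul_self_le_rpow_one_add (s := x⁻¹) (by linarith [inv_pos.2 hx]) hp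
  have h2 := mul_le_mul_of_nonneg_left h (Real.rpow_nonneg hx.le p)
  rw [← Real.mul_rpow hx.le (by positivity), mul_add, mul_add, mul_one, mul_one,
    mul_inv_cancel₀ hx.ne'] at h2
  have h3 : x ^ p * (p * x⁻¹) = p * x ^ (p - 1) := by
    rw [Real.rpow_sub_one hx.ne']
    ring
  linarith

/-- A polynomial bound `n ^ k` is beaten by an exponential, with a prescribed constant. -/
theorem eventually_mul_pow_lt_exp (A B : ℝ) (k : ℕ) {ε : ℝ} (hε : 0 < ε) :
    ∀ᶠ n : ℕ in atTop, A * (n : ℝ) ^ k < Real.exp (ε * n - B) := by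
  have h := (Real.tendsto_pow_mul_exp_neg_atTop_nhds_zero k).comp
    (tendsto_natCast_atTop_atTop.const_mul_atTop hε)
  have h2 := (h.const_mul (A * (ε ^ k)⁻¹ * Real.exp B))
  rw [mul_zero] at h2
  filter_upwards [h2.eventually (gt_mem_nhds one_pos)] with n hn
  simp only [Function.comp_apply, mul_pow] at hn
  have hpos := Real.exp_pos (ε * n - B)
  have e : A * (ε ^ k)⁻¹ * Real.exp B * (ε ^ k * (n : ℝ) ^ k * Real.exp (-(ε * n))) *
      Real.exp (ε * n - B) = A * (n : ℝ) ^ k := by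
    have e1 : Real.exp B * Real.exp (-(ε * n)) * Real.exp (ε * n - B) = 1 := by
      rw [← Real.exp_add, ← Real.exp_add, ← Real.exp_zero]
      congr 1
      ring
    have e2 : ε ^ k ≠ 0 := (pow_pos hε k).ne'
    calc _ = A * ((ε ^ k)⁻¹ * ε ^ k) * (n : ℝ) ^ k *
          (Real.exp B * Real.exp (-(ε * n)) * Real.exp (ε * n - B)) := by ring
      _ = _ := by rw [e1, inv_mul_cancel₀ e2, mul_one, mul_one]
  calc A * (n : ℝ) ^ k = _ := e.symm
    _ < 1 * Real.exp (ε * n - B) := mul_lt_mul_of_pos_right hn hpos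
    _ = _ := one_mul _

/-- From approximations of `L` of rank `R n` to approximation numbers of `L ^ q`: the number `n` of
the approximation is chosen as `⌈log m / H⌉ + 1`. -/
theorem approxNumber_pow_le_of_approx {E : Type*} [NormedAddCommGroup E] [NormedSpace ℂ E]
    (L : E →L[ℂ] E) {c p C H : ℝ} (hc : 0 < c) (hp : 1 ≤ p) (hC : 0 ≤ C) (hH : 0 < H)
    {R : ℕ → ℕ} {q : ℕ} (hq : 1 ≤ q)
    (h : ∀ n, 2 ≤ n → ∃ F : E →L[ℂ] E, (F : E →ₗ[ℂ] E).rank ≤ (R n : Cardinal) ∧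
      ‖L - F‖ ≤ C * Real.exp (-(c * (p * ((n : ℝ) - 1) ^ (p - 1)))))
    (hR : ∀ᶠ n : ℕ in atTop, (q * R n : ℝ) < Real.exp (H * (n - 2))) :
    ∃ C' : ℝ, 0 < C' ∧ ∀ m : ℕ, 1 ≤ m → approxNumber m (L ^ q) ≤
      C' * Real.exp (-(p * q * c * (Real.log ((m : ℝ) ^ (1 / H))) ^ (p - 1))) := by
  obtain ⟨n₀, hn₀⟩ := eventually_atTop.1 (hR.and (eventually_ge_atTop 2))
  have hp1 : 0 ≤ p - 1 := by linarith
  refine ⟨C ^ q + ‖L ^ q‖ * Real.exp (p * q * c * (n₀ : ℝ) ^ (p - 1)) + 1, by positivity,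
    fun m hm => ?_⟩
  have hm0 : (0 : ℝ) < m := by exact_mod_cast hm
  have hlog : Real.log ((m : ℝ) ^ (1 / H)) = Real.log m / H := by
    rw [Real.log_rpow hm0]
    ring
  rw [hlog]
  set t := Real.log m / H with ht
  have ht0 : 0 ≤ t := div_nonneg (Real.log_nonneg (by exact_mod_cast hm)) hH.le
  set n := ⌈t⌉₊ + 1 with hn
  have hn1 : t ≤ (n : ℝ) - 1 := by
    rw [hn]
    push_cast
    linarith [Nat.le_ceil t]
  have hn2 : (n : ℝ) - 2 ≤ t := by
    rw [hn]
    push_cast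
    linarith [Nat.ceil_lt_add_one ht0]
  have hX := Real.exp_pos (-(p * q * c * t ^ (p - 1)))
  have hY : 0 ≤ ‖L ^ q‖ * Real.exp (p * q * c * (n₀ : ℝ) ^ (p - 1)) := by positivity
  have hZ : 0 ≤ C ^ q := by positivity
  rcases le_or_gt n₀ n with hle | hlt
  · obtain ⟨hRn, hn2'⟩ := hn₀ n hle
    obtain ⟨F, hF, hLF⟩ := h n hn2'
    have hlt : q * R n < m := by
      have : Real.exp (H * (n - 2)) ≤ m := by
        rw [← Real.exp_log hm0]
        refine Real.exp_le_exp.2 ?_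
        rw [ht, le_div_iff₀ hH] at hn2
        linarith
      exact_mod_cast hRn.trans_le this
    refine (approxNumber_pow_le L F hq hF hlt).trans ?_
    have h1 : ‖L - F‖ ^ q ≤ C ^ q * Real.exp (-(p * q * c * t ^ (p - 1))) := by
      calc ‖L - F‖ ^ q ≤ (C * Real.exp (-(c * (p * ((n : ℝ) - 1) ^ (p - 1))))) ^ q :=
            pow_le_pow_left₀ (norm_nonneg _) hLF q
        _ = C ^ q * Real.exp (-(p * q * c * ((n : ℝ) - 1) ^ (p - 1))) := by
            rw [mul_pow, ← Real.exp_nat_mul]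
            congr 2
            ring
        _ ≤ _ := by
            have := Real.rpow_le_rpow ht0 hn1 hp1
            gcongr
    nlinarith
  -- The finitely many remaining `m` are covered by the norm of `L ^ q`.
  · have htn : t ≤ n₀ := by
      have : (n : ℝ) ≤ n₀ := by exact_mod_cast hlt.le
      linarith
    have h1 : ‖L ^ q‖ ≤ ‖L ^ q‖ * Real.exp (p * q * c * (n₀ : ℝ) ^ (p - 1)) *
        Real.exp (-(p * q * c * t ^ (p - 1))) := by
      rw [mul_assoc, ← Real.exp_add]
      refine le_mul_of_one_le_right (norm_nonneg _) (Real.one_le_exp ?_)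
      have h2 := Real.rpow_le_rpow ht0 htn hp1
      have h3 : 0 ≤ p * q * c := by positivity
      nlinarith
    refine (approxNumber_le_norm _ hm).trans (h1.trans ?_)
    nlinarith

end FastLyapunov

namespace FastLyapunov

/-- The gain of one symbol for `κ_n = exp (-c n ^ p)`: the index `max (k + 1) n` is the successor of
`max k (n - 1)`. -/
theorem exp_rpow_gain {c p : ℝ} (hc : 0 < c) (hp : 1 ≤ p) {k n : ℕ} (hk : 1 ≤ k) (hn : 1 ≤ n) :
    Real.exp (-c * ((max (k + 1) n : ℕ) : ℝ) ^ p) ≤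
      Real.exp (-c * (k : ℝ) ^ p) * Real.exp (-(c * (p * ((n : ℝ) - 1) ^ (p - 1)))) := by
  rw [← Real.exp_add, Real.exp_le_exp]
  obtain ⟨j, hj, hkj, hnj⟩ : ∃ j, max (k + 1) n = j + 1 ∧ k ≤ j ∧ n ≤ j + 1 :=
    ⟨max (k + 1) n - 1, by omega, by omega, by omega⟩
  have hk0 : (0 : ℝ) ≤ k := Nat.cast_nonneg k
  have hkj' : (k : ℝ) ≤ j := by exact_mod_cast hkj
  have hnj' : (n : ℝ) ≤ j + 1 := by exact_mod_cast hnj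
  have hn' : (1 : ℝ) ≤ n := by exact_mod_cast hn
  have hj0 : (0 : ℝ) < j := by
    have : 1 ≤ j := hk.trans hkj
    exact_mod_cast this
  have h1 := rpow_add_le_add_one_rpow hp hj0
  have h2 : (k : ℝ) ^ p ≤ (j : ℝ) ^ p := Real.rpow_le_rpow hk0 hkj' (by linarith)
  have h3 : ((n : ℝ) - 1) ^ (p - 1) ≤ (j : ℝ) ^ (p - 1) :=
    Real.rpow_le_rpow (by linarith) (by linarith) (by linarith)
  rw [hj]
  push_cast
  have h4 : p * ((n : ℝ) - 1) ^ (p - 1) ≤ p * (j : ℝ) ^ (p - 1) :=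
    mul_le_mul_of_nonneg_left h3 (by linarith)
  have h5 : c * ((k : ℝ) ^ p + p * ((n : ℝ) - 1) ^ (p - 1)) ≤ c * ((j : ℝ) + 1) ^ p :=
    mul_le_mul_of_nonneg_left (by linarith) hc.le
  linarith

/-- With `M` of polynomial size in `n`, the interpolation error `M ^ d / 2 ^ M` is negligible
against `exp (-c p (n - 1) ^ (p - 1))`. -/
theorem exists_degree {c p : ℝ} (hc : 0 < c) (hp : 1 ≤ p) (J d : ℕ) :
    ∃ (a s : ℕ) (B : ℝ), 0 < a ∧ 0 ≤ B ∧ ∀ n : ℕ, 1 ≤ n →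
      (1 + 2 * (J * (2 * (a * n ^ s)) ^ d : ℕ)) / 2 ^ (2 * (a * n ^ s)) ≤
        B * Real.exp (-(c * (p * ((n : ℝ) - 1) ^ (p - 1)))) := by
  -- One factor `2 ^ (-M / 2)` absorbs the polynomial, the other one is the required exponential.
  obtain ⟨B, hB⟩ :=
    (tendsto_pow_const_div_const_pow_of_one_lt d (one_lt_two (α := ℝ))).bddAbove_range
  have hB' : ∀ M : ℕ, (M : ℝ) ^ d ≤ max B 0 * 2 ^ M := fun M => by
    have := hB ⟨M, rfl⟩
    simp only at this
    rw [div_le_iff₀ (by positivity)] at this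
    exact this.trans (mul_le_mul_of_nonneg_right (le_max_left _ _) (by positivity))
  set a := ⌈c * p / Real.log 2⌉₊ + 1 with ha
  set s := ⌈p⌉₊ with hs
  have hlog := Real.log_pos one_lt_two
  have ha' : c * p ≤ a * Real.log 2 := by
    rw [← div_le_iff₀ hlog, ha]
    push_cast
    linarith [Nat.le_ceil (c * p / Real.log 2)]
  refine ⟨a, s, 1 + 2 * (J * 2 ^ d * max B 0), Nat.succ_pos _, by positivity, fun n hn => ?_⟩
  set M := a * n ^ s with hM
  have hn' : (1 : ℝ) ≤ n := by exact_mod_cast hn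
  have hpow : ((n : ℝ) - 1) ^ (p - 1) ≤ (n : ℝ) ^ s := by
    calc ((n : ℝ) - 1) ^ (p - 1) ≤ (n : ℝ) ^ (p - 1) :=
          Real.rpow_le_rpow (by linarith) (by linarith) (by linarith)
      _ ≤ (n : ℝ) ^ (s : ℝ) := Real.rpow_le_rpow_of_exponent_le hn' (by linarith [Nat.le_ceil p])
      _ = _ := Real.rpow_natCast _ _
  have hsmall : ((2 : ℝ) ^ M)⁻¹ ≤ Real.exp (-(c * (p * ((n : ℝ) - 1) ^ (p - 1)))) := by
    rw [← Real.exp_log (show (0 : ℝ) < 2 ^ M by positivity), ← Real.exp_neg, Real.exp_le_exp,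
      Real.log_pow, hM]
    push_cast
    have h1 : c * p * ((n : ℝ) - 1) ^ (p - 1) ≤ c * p * (n : ℝ) ^ s :=
      mul_le_mul_of_nonneg_left hpow (by positivity)
    have h2 : c * p * (n : ℝ) ^ s ≤ a * Real.log 2 * (n : ℝ) ^ s :=
      mul_le_mul_of_nonneg_right ha' (by positivity)
    linarith
  have hnum : (1 + 2 * (J * (2 * M) ^ d : ℕ) : ℝ) ≤ (1 + 2 * (J * 2 ^ d * max B 0)) * 2 ^ M := by
    have h1 : (1 : ℝ) ≤ 2 ^ M := one_le_pow₀ one_le_two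
    have h2 := mul_le_mul_of_nonneg_left (hB' M) (show (0 : ℝ) ≤ J * 2 ^ d by positivity)
    push_cast
    rw [mul_pow]
    linarith
  have h2M : (2 : ℝ) ^ (2 * M) = 2 ^ M * 2 ^ M := by rw [two_mul, pow_add]
  have hpos : (0 : ℝ) < 2 ^ M := by positivity
  calc (1 + 2 * (J * (2 * M) ^ d : ℕ) : ℝ) / 2 ^ (2 * M)
      ≤ ((1 + 2 * (J * 2 ^ d * max B 0)) * 2 ^ M) / 2 ^ (2 * M) := by gcongr
    _ = (1 + 2 * (J * 2 ^ d * max B 0)) * ((2 : ℝ) ^ M)⁻¹ := by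
        rw [h2M]
        field_simp
    _ ≤ _ := by gcongr

/-- The ranks of the approximations are below the exponential growth rate of any `H > h_top`. -/
theorem eventually_rank_lt {N : ℕ} {T : Matrix (Fin N) (Fin N) ℕ} [Nonempty (SFT T)] {ε : ℝ}
    (hε : 0 < ε) (J d a s q : ℕ) :
    ∀ᶠ n : ℕ in atTop, (q * ((SFT.words T n).ncard * (J * (2 * (a * n ^ s)) ^ d) : ℕ) : ℝ) <
      Real.exp ((SFT.entropy T + ε) * (n - 2)) := by
  filter_upwards [SFT.eventually_words_le (T := T) (half_pos hε),
    eventually_mul_pow_lt_exp (q * J * (2 * a) ^ d) (2 * (SFT.entropy T + ε)) (s * d)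
      (half_pos hε)] with n h1 h2
  set E := Real.exp ((SFT.entropy T + ε / 2) * n) with hE
  have hE0 : 0 < E := Real.exp_pos _
  calc (q * ((SFT.words T n).ncard * (J * (2 * (a * n ^ s)) ^ d) : ℕ) : ℝ)
      = (SFT.words T n).ncard * (q * J * (2 * a) ^ d * (n : ℝ) ^ (s * d)) := by
        push_cast
        rw [pow_mul, ← mul_assoc 2 (a : ℝ), mul_pow (2 * (a : ℝ))]
        ring
    _ ≤ E * (q * J * (2 * a) ^ d * (n : ℝ) ^ (s * d)) := by gcongr
    _ < E * Real.exp (ε / 2 * n - 2 * (SFT.entropy T + ε)) := mul_lt_mul_of_pos_left h2 hE0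
    _ = _ := by
        rw [hE, ← Real.exp_add]
        congr 1
        ring

end FastLyapunov

theorem mainTheorem3 {N d m : ℕ} (T : Matrix (Fin N) (Fin N) ℕ)
    (hT : ∀ i j, T i j = 0 ∨ T i j = 1)
    (φ : SFT T → ℝ) (A : SFT T → GL (Fin d) ℝ)
    (K : Fin m → Set (Fin d → ℝ)) (w : Fin d → ℝ) (hA : HypH1 A K w)
    (β : ℝ) (ν : Seminorm ℝ (Fin d → ℝ)) (ℓ : (Fin d → ℂ) → ℂ)
    (hℓ : IsLogNorm (domain K w) β ν ℓ)
    (c p : ℝ) (hc : 0 < c) (hp : 1 ≤ p)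
    (κ : ℕ → ℝ) (hκ : ∀ n, κ n = Real.exp (-c * (n : ℝ) ^ p))
    (hvarφ : SFT.VarBigO φ κ)
    (hvarA : SFT.VarBigO
      (fun x => Matrix.toEuclideanCLM (𝕜 := ℝ) (A x : Matrix (Fin d) (Fin d) ℝ)) κ) :
    ∃ L : BSpace T (domain K w) κ →L[ℂ] BSpace T (domain K w) κ,
      (∀ f : BSpace T (domain K w) κ, ∀ x, ∀ z ∈ domain K w,
        (L f).toFun x z = transfer φ A w ℓ β f.toFun x z) ∧
      ∀ q : ℕ, 1 ≤ q → ∀ ε : ℝ, 0 < ε → ∃ C : ℝ, 0 < C ∧ ∀ n : ℕ, 1 ≤ n →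
        approxNumber n (L ^ q) ≤
          C * Real.exp (-(p * q * c *
            (Real.log ((n : ℝ) ^ (1 / (SFT.entropy T + ε)))) ^ (p - 1))) := by
  obtain ⟨_, x₀, -⟩ := hA.isMulticone.set_nonempty
  have : Nonempty (SFT T) := ⟨x₀⟩
  have hp0 : 0 < p := by linarith
  have hκpos : ∀ k, 0 < κ k := fun k => by rw [hκ]; exact Real.exp_pos _
  have hκa : Antitone κ := fun k l hkl => by
    rw [hκ, hκ, Real.exp_le_exp, neg_mul, neg_mul, neg_le_neg_iff]
    have : (k : ℝ) ≤ l := by exact_mod_cast hkl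
    gcongr
  have hκ1 : ∀ k, κ k ≤ 1 := fun k => by
    rw [hκ, Real.exp_le_one_iff, neg_mul, neg_nonpos]
    positivity
  have hκ0 : Tendsto κ atTop (𝓝 0) := by
    have h1 : Tendsto (fun n : ℕ => -(c * (n : ℝ) ^ p)) atTop atBot :=
      tendsto_neg_atTop_atBot.comp
        (((tendsto_rpow_atTop hp0).comp tendsto_natCast_atTop_atTop).const_mul_atTop hc)
    refine (Real.tendsto_exp_atBot.comp h1).congr fun n => ?_
    rw [Function.comp_apply, hκ, neg_mul]
  obtain ⟨S, hS, hSU, hτS, hτd, hwd, hτ, hG⟩ := exists_kernel_data hκpos hκ0 hA hℓ hvarφ hvarA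
  obtain ⟨L, hL, J, C, C', hC, hC', happ⟩ := exists_transfer_approx
    (θ := fun n => Real.exp (-(c * (p * ((n : ℝ) - 1) ^ (p - 1))))) x₀ hκpos hκa hκ1 hκ0
    (fun k n hk hn => by rw [hκ, hκ]; exact exp_rpow_gain hc hp hk (by omega))
    (isOpen_preimage_domain hA.isMulticone.unit K) hA.isMulticone.unit
    (fun z hz => pair_of_mem_domain hz) hG hτ (fun y => (hwd y).const_mul _) hτd hS hSU hτS
  refine ⟨L, hL, fun q hq ε hε => ?_⟩
  obtain ⟨a, s, B, ha, hB, hdeg⟩ := exists_degree hc hp J d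
  refine approxNumber_pow_le_of_approx L (C := C * (1 + C' * B)) hc hp (by positivity)
    (add_pos_of_nonneg_of_pos SFT.entropy_nonneg hε) hq (fun n hn => ?_)
    (eventually_rank_lt hε J d a s q)
  obtain ⟨F, hF, hLF⟩ := happ (2 * (a * n ^ s)) n (by positivity) hn
  refine ⟨F, hF, hLF.trans ?_⟩
  have := mul_le_mul_of_nonneg_left (hdeg n (by omega)) hC'
  rw [mul_assoc C]
  refine mul_le_mul_of_nonneg_left ?_ hC
  rw [add_mul, one_mul, mul_assoc, mul_div_assoc]
  linarith
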